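/- Let $m\ge 2$ and $J\ge 2$ be integers, let $p_1,\dots,p_J$ be distinct primes, and let $S=\{\ell_1<\ell_2<\cdots\}$, $\ell_1=1$, be the multiplicative semigroup of all products $p_1^{a_1}\cdots p_J^{a_J}$ with $a_j\ge 0$. Put $\gamma(S)=\sum_{k\ge1} 1/\ell_k$. Let $\Sigma_m=\{0,\dots,m-1\}^{\{1,2,\dots\}}$ with the metric $\varrho(x,y)=m^{-\min\{n:\,x_n\ne y_n\}}$ for $x\neq y$ (and $\varrho(x,x)=0$), let $\Omega\subset\Sigma_m$ be closed and nonempty, and let $$X_\Omega^{(S)}=\bigl\{x\in\Sigma_m:\ (x_{i\ell_k})_{k\ge1}\in\Omega\ \text{ for every integer } i\ge1 \text{ divisible by none of } p_1,\dots,p_J\bigr\}.$$ For $k\ge 0$ let $\mathrm{Pref}_k(\Omega)$ be the set of words of length $k$ that are initial segments of elements of $\Omega$. For a Borel probability measure $\mu$ on $\Omega$ let $\alpha_k$ be the partition of $\Omega$ into the nonempty cylinder sets $\Omega\cap[u]$, $u\in\mathrm{Pref}_k(\Omega)$, where $[u]$ is the set of sequences beginning with $u$; let $H^\mu(\alpha_k)=-\sum_{B\in\alpha_k}\mu(B)\log_m\mu(B)$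 (with $0\log_m 0=0$), and $$s(\Omega,\mu)=\gamma(S)^{-1}\sum_{k=1}^\infty H^\mu(\alpha_k)\Bigl(\frac1{\ell_k}-\frac1{\ell_{k+1}}\Bigr).$$ Then the series defining $\gamma(S)$ and $s(\Omega,\mu)$ converge, and the following hold, all dimensions being taken with respect to $\varrho$. (i) $\dim_H X_\Omega^{(S)}=\sup_\mu s(\Omega,\mu)$, the supremum being over all Borel probability measures $\mu$ on $\Omega$. (ii) The Minkowski (box-counting) dimension $\dim_M X_\Omega^{(S)}$ exists, and $\dim_H X_\Omega^{(S)}=\dim_M X_\Omega^{(S)}$ if and only if the tree of prefixes of $\Omega$ is spherically symmetric, i.e. for every $k$ all $u\in\mathrm{Pref}_k(\Omega)$ have the same number of continuations in $\mathrm{Pref}_{k+1}(\Omega)$. -/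

import Mathlib

open Set Filter Topology MeasureTheory
open scoped NNReal ENNReal

noncomputable section

/-- The symbolic space `Σ_m` of infinite sequences of digits in `{0, …, m-1}`.  Positions are counted
from `0` here, so the digit which is usually written `x_n`, `n ≥ 1`, is `x (n - 1)`. -/
@[ext]
structure SymbolicSpace (m : ℕ) where
  digit : ℕ → Fin m

namespace SymbolicSpace

variable {m : ℕ}

instance instCoeFun : CoeFun (SymbolicSpace m) (fun _ => ℕ → Fin m) := ⟨digit⟩

/-- The standard metric `ϱ(x, y) = m ^ (-min {n ≥ 1 : x_n ≠ y_n})` (and `ϱ(x, x) = 0`).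
Since `PiNat.firstDiff` is the first place of disagreement counted from `0`, the exponent is
`firstDiff + 1`. -/
instance instDist : Dist (SymbolicSpace m) where
  dist x y := open Classical in
    if x = y then 0 else ((m : ℝ)⁻¹) ^ (PiNat.firstDiff x.digit y.digit + 1)

theorem dist_def (x y : SymbolicSpace m) : dist x y = open Classical in
    if x = y then 0 else ((m : ℝ)⁻¹) ^ (PiNat.firstDiff x.digit y.digit + 1) := rfl

theorem dist_of_ne {x y : SymbolicSpace m} (h : x ≠ y) :
    dist x y = ((m : ℝ)⁻¹) ^ (PiNat.firstDiff x.digit y.digit + 1) := by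
  simp [dist_def, h]

theorem dist_self' (x : SymbolicSpace m) : dist x x = 0 := by simp [dist_def]

theorem dist_nonneg' (x y : SymbolicSpace m) : 0 ≤ dist x y := by
  rw [dist_def]; split_ifs <;> positivity

instance instMetricSpace : MetricSpace (SymbolicSpace m) where
  dist_self := dist_self'
  dist_comm x y := by
    by_cases h : x = y
    · rw [h]
    · rw [dist_of_ne h, dist_of_ne (Ne.symm h), PiNat.firstDiff_comm]
  dist_triangle x y z := by
    by_cases hxz : x = z
    · rw [hxz, dist_self']
      exact add_nonneg (dist_nonneg' _ _) (dist_nonneg' _ _)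
    by_cases hxy : x = y
    · rw [hxy, dist_self', zero_add]
    by_cases hyz : y = z
    · rw [hyz, dist_self', add_zero]
    have hm : (1 : ℝ) ≤ m := by exact_mod_cast (x 0).pos
    have h0 : (0 : ℝ) ≤ (m : ℝ)⁻¹ := by positivity
    have h1 : (m : ℝ)⁻¹ ≤ 1 := inv_le_one_of_one_le₀ hm
    have hmin := PiNat.min_firstDiff_le x.digit y.digit z.digit (fun h => hxz (SymbolicSpace.ext h))
    rcases min_le_iff.1 hmin with h | h
    · have : dist x z ≤ dist x y := by
        rw [dist_of_ne hxz, dist_of_ne hxy]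
        exact pow_le_pow_of_le_one h0 h1 (by omega)
      linarith [dist_nonneg' y z]
    · have : dist x z ≤ dist y z := by
        rw [dist_of_ne hxz, dist_of_ne hyz]
        exact pow_le_pow_of_le_one h0 h1 (by omega)
      linarith [dist_nonneg' x y]
  eq_of_dist_eq_zero {x y} h := by
    by_contra hne
    have hm : (0 : ℝ) < m := by exact_mod_cast (x 0).pos
    rw [dist_of_ne hne] at h
    exact (ne_of_gt (by positivity)) h

instance instMeasurableSpace : MeasurableSpace (SymbolicSpace m) := borel _

instance instBorelSpace : BorelSpace (SymbolicSpace m) := ⟨rfl⟩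

/-- The cylinder `[u]` of all sequences starting with the word `u` of length `k`. -/
def cylinder {k : ℕ} (u : Fin k → Fin m) : Set (SymbolicSpace m) :=
  {x | ∀ i : Fin k, x i = u i}

/-- `Pref_k(Ω)`: the words `u` of length `k` with `Ω ∩ [u] ≠ ∅`. -/
def prefixes (Ω : Set (SymbolicSpace m)) (k : ℕ) : Finset (Fin k → Fin m) :=
  open Classical in Finset.univ.filter fun u => (Ω ∩ cylinder u).Nonempty

/-- The digits `a` such that the word `u a` is a prefix of `Ω`, for a word `u` of length `k`: the
continuations of `u` in `Pref_{k+1}(Ω)`. -/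
def continuations (Ω : Set (SymbolicSpace m)) {k : ℕ} (u : Fin k → Fin m) : Finset (Fin m) :=
  open Classical in
    Finset.univ.filter fun a => (Fin.snoc u a : Fin (k + 1) → Fin m) ∈ prefixes Ω (k + 1)

/-- The tree of prefixes of `Ω` is spherically symmetric: for every `k`, all prefixes of length `k`
have the same number of continuations. -/
def PrefixTreeSphericallySymmetric (Ω : Set (SymbolicSpace m)) : Prop :=
  ∀ k : ℕ, ∀ u ∈ prefixes Ω k, ∀ v ∈ prefixes Ω k,
    (continuations Ω u).card = (continuations Ω v).card

/-- The Shannon entropy `H^μ(α_k)`, with logarithms to base `m`, of the partition `α_k` of `Ω` into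
its (nonempty) cylinders of length `k`. -/
def cylinderEntropy (Ω : Set (SymbolicSpace m)) (μ : Measure Ω) (k : ℕ) : ℝ :=
  -∑ u ∈ prefixes Ω k,
    μ.real {x : Ω | x.1 ∈ cylinder u} * Real.logb m (μ.real {x : Ω | x.1 ∈ cylinder u})

end SymbolicSpace

/-- The multiplicative semigroup `S` (containing `1`) generated by `p_1, …, p_J`. -/
def primeSemigroup {J : ℕ} (p : Fin J → ℕ) : Submonoid ℕ := Submonoid.closure (Set.range p)

/-- The increasing enumeration of `S`, counted from `0`: `ell p k` is the element usually written
`ℓ_{k+1}`, so that `ell p 0 = ℓ_1 = 1`. -/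
def ell {J : ℕ} (p : Fin J → ℕ) (k : ℕ) : ℕ := Nat.nth (fun n => n ∈ primeSemigroup p) k

/-- `γ(S) = ∑ 1 / ℓ_k`. -/
def gammaS {J : ℕ} (p : Fin J → ℕ) : ℝ := ∑' k : ℕ, 1 / (ell p k : ℝ)

namespace SymbolicSpace

variable {m : ℕ}

/-- The subsequence `x|_{iS} = (x_{i ℓ_k})_{k ≥ 1}` for `i ≥ 1`; the `- 1` passes from the usual
numbering of the positions to the one from `0`. -/
def restrict {J : ℕ} (p : Fin J → ℕ) (i : ℕ) (x : SymbolicSpace m) : SymbolicSpace m :=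
  ⟨fun k => x (i * ell p k - 1)⟩

/-- The set `X_Ω^{(S)}` of all `x` with `x|_{iS} ∈ Ω` for every positive integer `i` not divisible by
any of the `p_j`. -/
def fractal {J : ℕ} (p : Fin J → ℕ) (Ω : Set (SymbolicSpace m)) : Set (SymbolicSpace m) :=
  {x | ∀ i : ℕ, 1 ≤ i → (∀ j, ¬ p j ∣ i) → restrict p i x ∈ Ω}

/-- The term `H^μ(α_k) (1/ℓ_k - 1/ℓ_{k+1})`, `k ≥ 1`, of the series below, with `k` shifted by `1`. -/
def entropyTerm {J : ℕ} (p : Fin J → ℕ) (Ω : Set (SymbolicSpace m)) (μ : Measure Ω) (k : ℕ) : ℝ :=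
  cylinderEntropy Ω μ (k + 1) * (1 / (ell p k : ℝ) - 1 / (ell p (k + 1) : ℝ))

/-- `s(Ω, μ) = γ(S)⁻¹ ∑_{k ≥ 1} H^μ(α_k) (1/ℓ_k - 1/ℓ_{k+1})`. -/
def entropySum {J : ℕ} (p : Fin J → ℕ) (Ω : Set (SymbolicSpace m)) (μ : Measure Ω) : ℝ :=
  (gammaS p)⁻¹ * ∑' k : ℕ, entropyTerm p Ω μ k

end SymbolicSpace

/-- `A` has Minkowski (box-counting) dimension `d`: with `N(ε)` the least number of closed balls of
radius `ε` centred in `A` that cover `A`, all `N(ε)` are finite, and `log N(ε) / log (1/ε)` tends to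
`d` as `ε → 0`. -/
def HasMinkowskiDim {X : Type*} [MetricSpace X] (A : Set X) (d : ℝ) : Prop :=
  (∀ ε : ℝ≥0, 0 < ε → Metric.coveringNumber ε A ≠ ⊤) ∧
    Tendsto (fun ε : ℝ≥0 => Real.log ((Metric.coveringNumber ε A).toNat : ℝ) / Real.log (1 / (ε : ℝ)))
      (𝓝[>] 0) (𝓝 d)

end

noncomputable section

section NumberTheory

variable {J : ℕ} {p : Fin J → ℕ}

theorem primeSemigroup_pos (hp : ∀ j, (p j).Prime) {s : ℕ} (hs : s ∈ primeSemigroup p) : 0 < s := by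
  induction hs using Submonoid.closure_induction with
  | mem x hx => obtain ⟨j, rfl⟩ := hx; exact (hp j).pos
  | one => exact one_pos
  | mul x y _ _ hx hy => exact Nat.mul_pos hx hy

theorem primeSemigroup_infinite (hJ : 0 < J) (hp : ∀ j, (p j).Prime) :
    (Set.ofPred fun n => n ∈ primeSemigroup p).Infinite := by
  refine Set.infinite_of_injective_forall_mem (f := fun n : ℕ => p ⟨0, hJ⟩ ^ n)
    (Nat.pow_right_injective (hp _).two_le) fun n => ?_
  exact Submonoid.pow_mem _ (Submonoid.subset_closure (Set.mem_range_self _)) n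

theorem ell_mem (hJ : 0 < J) (hp : ∀ j, (p j).Prime) (k : ℕ) : ell p k ∈ primeSemigroup p :=
  Nat.nth_mem_of_infinite (primeSemigroup_infinite hJ hp) k

theorem ell_strictMono (hJ : 0 < J) (hp : ∀ j, (p j).Prime) : StrictMono (ell p) :=
  Nat.nth_strictMono (primeSemigroup_infinite hJ hp)

theorem ell_pos (hJ : 0 < J) (hp : ∀ j, (p j).Prime) (k : ℕ) : 0 < ell p k :=
  primeSemigroup_pos hp (ell_mem hJ hp k)

theorem ell_pos_real (hJ : 0 < J) (hp : ∀ j, (p j).Prime) (k : ℕ) : (0 : ℝ) < ell p k := by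
  exact_mod_cast ell_pos hJ hp k

theorem exists_ell_eq {s : ℕ} (hs : s ∈ primeSemigroup p) : ∃ k, ell p k = s := by
  classical
  exact ⟨_, Nat.nth_count (p := fun n => n ∈ primeSemigroup p) hs⟩

theorem ell_zero (hJ : 0 < J) (hp : ∀ j, (p j).Prime) : ell p 0 = 1 := by
  obtain ⟨k, hk⟩ := exists_ell_eq (p := p) (one_mem (primeSemigroup p))
  have h1 := (ell_strictMono hJ hp).monotone (Nat.zero_le k)
  have h2 := ell_pos hJ hp 0
  omega

theorem lt_ell (hJ : 0 < J) (hp : ∀ j, (p j).Prime) (k : ℕ) : k < ell p k := by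
  induction k with
  | zero => exact ell_pos hJ hp 0
  | succ k ih => have := ell_strictMono hJ hp (Nat.lt_add_one k); omega

theorem primeSemigroup_subset_factoredNumbers (hp : ∀ j, (p j).Prime) {s : ℕ}
    (hs : s ∈ primeSemigroup p) : s ∈ Nat.factoredNumbers (Finset.univ.image p) := by
  induction hs using Submonoid.closure_induction with
  | mem x hx =>
    obtain ⟨j, rfl⟩ := hx
    rw [Nat.mem_factoredNumbers']
    intro q hq hd
    rw [(Nat.prime_dvd_prime_iff_eq hq (hp j)).1 hd]
    simp
  | one => rw [Nat.mem_factoredNumbers']; intro q hq hd; exact absurd (Nat.dvd_one.1 hd) hq.ne_one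
  | mul x y _ _ hx hy => exact Nat.mul_mem_factoredNumbers hx hy

theorem summable_inv_ell (hJ : 0 < J) (hp : ∀ j, (p j).Prime) :
    Summable fun k => 1 / (ell p k : ℝ) := by
  let f : ℕ →* ℝ :=
    { toFun := fun n => (n : ℝ)⁻¹
      map_one' := by simp
      map_mul' := fun a b => by simp [mul_comm] }
  have h := (EulerProduct.summable_and_hasSum_factoredNumbers_prod_filter_prime_geometric (f := f)
    (fun {q} hq => by
      have : (1 : ℝ) < q := by exact_mod_cast hq.one_lt
      simp only [f, MonoidHom.coe_mk, OneHom.coe_mk, norm_inv, RCLike.norm_natCast]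
      exact inv_lt_one_of_one_lt₀ this) (Finset.univ.image p)).1
  have h2 := h.comp_injective (i := fun k : ℕ =>
    (⟨ell p k, primeSemigroup_subset_factoredNumbers hp (ell_mem hJ hp k)⟩ :
      Nat.factoredNumbers (Finset.univ.image p)))
    (fun a b hab => (ell_strictMono hJ hp).injective (by simpa using hab))
  refine h2.congr fun k => ?_
  simp [f]

/-- The numbers divisible by none of the `p j`. -/
def IsCore (p : Fin J → ℕ) (i : ℕ) : Prop := ∀ j, ¬ p j ∣ i

theorem IsCore.pos (hJ : 0 < J) {i : ℕ} (h : IsCore p i) : 0 < i := by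
  rcases Nat.eq_zero_or_pos i with rfl | h0
  · exact absurd (dvd_zero _) (h ⟨0, hJ⟩)
  · exact h0

theorem IsCore.coprime (hp : ∀ j, (p j).Prime) {i s : ℕ} (h : IsCore p i)
    (hs : s ∈ primeSemigroup p) : Nat.Coprime i s := by
  induction hs using Submonoid.closure_induction with
  | mem x hx =>
    obtain ⟨j, rfl⟩ := hx
    exact ((Nat.Prime.coprime_iff_not_dvd (hp j)).2 (h j)).symm
  | one => exact Nat.coprime_one_right i
  | mul x y _ _ hx hy => exact Nat.Coprime.mul_right hx hy

theorem exists_core_mul (hp : ∀ j, (p j).Prime) (r : ℕ) (hr : 0 < r) :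
    ∃ i s, IsCore p i ∧ s ∈ primeSemigroup p ∧ i * s = r := by
  induction r using Nat.strong_induction_on with
  | _ r ih =>
    by_cases h : IsCore p r
    · exact ⟨r, 1, h, one_mem _, mul_one r⟩
    · simp only [IsCore, not_forall, not_not] at h
      obtain ⟨j, t, rfl⟩ := h
      have ht : 0 < t := Nat.pos_of_mul_pos_left hr
      obtain ⟨i, s, hi, hs, rfl⟩ := ih t (by nlinarith [(hp j).two_le]) ht
      exact ⟨i, p j * s, hi, mul_mem (Submonoid.subset_closure ⟨j, rfl⟩) hs, by ring⟩

theorem core_mul_unique (hp : ∀ j, (p j).Prime) {i s i' s' : ℕ} (hi : IsCore p i)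
    (hs : s ∈ primeSemigroup p) (hi' : IsCore p i') (hs' : s' ∈ primeSemigroup p)
    (h : i * s = i' * s') : i = i' ∧ s = s' := by
  have h1 : s ∣ s' := (hi'.coprime hp hs).symm.dvd_of_dvd_mul_left (h ▸ dvd_mul_left s i)
  have h2 : s' ∣ s := (hi.coprime hp hs').symm.dvd_of_dvd_mul_left (h ▸ dvd_mul_left s' i')
  have h3 := Nat.dvd_antisymm h1 h2
  subst h3
  exact ⟨Nat.eq_of_mul_eq_mul_right (primeSemigroup_pos hp hs) h, rfl⟩

theorem exists_core_idx (hp : ∀ j, (p j).Prime) (r : ℕ) (hr : 0 < r) :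
    ∃ q : ℕ × ℕ, IsCore p q.1 ∧ q.1 * ell p q.2 = r := by
  obtain ⟨i, s, hi, hs, h⟩ := exists_core_mul hp r hr
  obtain ⟨k, rfl⟩ := exists_ell_eq hs
  exact ⟨(i, k), hi, h⟩

open Classical in
/-- The pair `(i, k)` with `r = i * ell p k` and `i` divisible by none of the `p j`. -/
def coreIdx (p : Fin J → ℕ) (r : ℕ) : ℕ × ℕ :=
  if h : ∃ q : ℕ × ℕ, IsCore p q.1 ∧ q.1 * ell p q.2 = r then h.choose else (1, 0)

def core (p : Fin J → ℕ) (r : ℕ) : ℕ := (coreIdx p r).1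

def idx (p : Fin J → ℕ) (r : ℕ) : ℕ := (coreIdx p r).2

theorem coreIdx_spec (hp : ∀ j, (p j).Prime) {r : ℕ} (hr : 0 < r) :
    IsCore p (core p r) ∧ core p r * ell p (idx p r) = r := by
  have h := exists_core_idx hp r hr
  rw [core, idx, coreIdx, dif_pos h]
  exact h.choose_spec

theorem isCore_core (hp : ∀ j, (p j).Prime) {r : ℕ} (hr : 0 < r) : IsCore p (core p r) :=
  (coreIdx_spec hp hr).1

theorem core_mul_ell (hp : ∀ j, (p j).Prime) {r : ℕ} (hr : 0 < r) :
    core p r * ell p (idx p r) = r :=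
  (coreIdx_spec hp hr).2

theorem core_idx_mul (hJ : 0 < J) (hp : ∀ j, (p j).Prime) {i : ℕ} (hi : IsCore p i) (k : ℕ) :
    core p (i * ell p k) = i ∧ idx p (i * ell p k) = k := by
  have hr : 0 < i * ell p k := Nat.mul_pos (hi.pos hJ) (ell_pos hJ hp k)
  have h := coreIdx_spec hp hr
  have h2 := core_mul_unique hp h.1 (ell_mem hJ hp _) hi (ell_mem hJ hp _) h.2
  exact ⟨h2.1, (ell_strictMono hJ hp).injective h2.2⟩

theorem core_mul (hJ : 0 < J) (hp : ∀ j, (p j).Prime) {i : ℕ} (hi : IsCore p i) (k : ℕ) :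
    core p (i * ell p k) = i := (core_idx_mul hJ hp hi k).1

theorem idx_mul (hJ : 0 < J) (hp : ∀ j, (p j).Prime) {i : ℕ} (hi : IsCore p i) (k : ℕ) :
    idx p (i * ell p k) = k := (core_idx_mul hJ hp hi k).2

open Classical in
/-- The number of `k` with `i * ell p k ≤ n`. -/
def chainLen (p : Fin J → ℕ) (n i : ℕ) : ℕ := Nat.count (fun s => s ∈ primeSemigroup p) (n / i + 1)

theorem lt_chainLen_iff (hJ : 0 < J) (hp : ∀ j, (p j).Prime) {n i k : ℕ} (hi : 0 < i) :
    k < chainLen p n i ↔ i * ell p k ≤ n := by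
  classical
  rw [chainLen, ← not_le, Nat.count_le_iff_le_nth (primeSemigroup_infinite hJ hp), not_le,
    Nat.lt_succ_iff, Nat.le_div_iff_mul_le hi, mul_comm]
  rfl

open Classical in
/-- The cores between `1` and `n`. -/
def coresUpTo (p : Fin J → ℕ) (n : ℕ) : Finset ℕ := (Finset.range (n + 1)).filter (IsCore p)

theorem mem_coresUpTo {n i : ℕ} : i ∈ coresUpTo p n ↔ i ≤ n ∧ IsCore p i := by
  simp [coresUpTo]

/-- Regrouping the integers in `[1, n]` along the chains `i * ell p k`. -/
@[to_additive /-- Regrouping the integers in `[1, n]` along the chains `i * ell p k`. -/]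
theorem prod_Icc_eq_prod_chains {M : Type*} [CommMonoid M] (hJ : 0 < J) (hp : ∀ j, (p j).Prime)
    (n : ℕ) (h : ℕ → ℕ → M) :
    ∏ r ∈ Finset.Icc 1 n, h (core p r) (idx p r) =
      ∏ i ∈ coresUpTo p n, ∏ k ∈ Finset.range (chainLen p n i), h i k := by
  rw [Finset.prod_sigma']
  refine Finset.prod_bij' (fun r _ => ⟨core p r, idx p r⟩) (fun q _ => q.1 * ell p q.2) ?_ ?_ ?_ ?_ ?_
  · intro r hr
    obtain ⟨h1, h2⟩ := Finset.mem_Icc.1 hr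
    obtain ⟨h3, h4⟩ := coreIdx_spec hp h1
    rw [Finset.mem_sigma, mem_coresUpTo, Finset.mem_range, lt_chainLen_iff hJ hp (h3.pos hJ), h4]
    refine ⟨⟨le_trans ?_ h2, h3⟩, h2⟩
    calc core p r ≤ core p r * ell p (idx p r) := Nat.le_mul_of_pos_right _ (ell_pos hJ hp _)
      _ = r := h4
  · intro q hq
    rw [Finset.mem_sigma, mem_coresUpTo, Finset.mem_range] at hq
    rw [lt_chainLen_iff hJ hp (hq.1.2.pos hJ)] at hq
    exact Finset.mem_Icc.2 ⟨Nat.mul_pos (hq.1.2.pos hJ) (ell_pos hJ hp _), hq.2⟩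
  · intro r hr
    exact core_mul_ell hp (Finset.mem_Icc.1 hr).1
  · intro q hq
    rw [Finset.mem_sigma, mem_coresUpTo] at hq
    have := core_idx_mul hJ hp hq.1.2 q.2
    ext <;> simp [this.1, this.2]
  · intro r hr
    rfl

open Classical in
/-- The number of cores in `[1, n]`. -/
def coreCount (p : Fin J → ℕ) (n : ℕ) : ℕ := Nat.count (IsCore p) (n + 1)

theorem card_coresUpTo (n : ℕ) : (coresUpTo p n).card = coreCount p n := by
  classical
  rw [coreCount, Nat.count_eq_card_filter_range, coresUpTo]

theorem coreCount_le (hJ : 0 < J) (n : ℕ) : coreCount p n ≤ n := by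
  classical
  have h0 : ¬ IsCore p 0 := fun h => absurd (h.pos hJ) (lt_irrefl 0)
  rw [coreCount, Nat.count_succ']
  simp only [h0, if_false, add_zero]
  exact Nat.count_le _

theorem sum_Icc_idx_eq (hJ : 0 < J) (hp : ∀ j, (p j).Prime) (n : ℕ) (h : ℕ → ℕ → ℝ) :
    ∑ r ∈ Finset.Icc 1 n, h (core p r) (idx p r) =
      ∑ k ∈ Finset.range (n + 1), ∑ i ∈ coresUpTo p (n / ell p k), h i k := by
  rw [sum_Icc_eq_sum_chains hJ hp]
  rw [Finset.sum_sigma', Finset.sum_sigma']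
  refine Finset.sum_bij' (fun q _ => ⟨q.2, q.1⟩) (fun q _ => ⟨q.2, q.1⟩) ?_ ?_ ?_ ?_ ?_
  · intro q hq
    rw [Finset.mem_sigma, mem_coresUpTo, Finset.mem_range] at hq
    rw [lt_chainLen_iff hJ hp (hq.1.2.pos hJ)] at hq
    rw [Finset.mem_sigma, mem_coresUpTo, Finset.mem_range, Nat.le_div_iff_mul_le (ell_pos hJ hp _)]
    refine ⟨?_, hq.2, hq.1.2⟩
    have h1 := lt_ell hJ hp q.2
    have h2 := hq.1.2.pos hJ
    nlinarith [hq.2]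
  · intro q hq
    rw [Finset.mem_sigma, mem_coresUpTo, Finset.mem_range,
      Nat.le_div_iff_mul_le (ell_pos hJ hp _)] at hq
    rw [Finset.mem_sigma, mem_coresUpTo, Finset.mem_range,
      lt_chainLen_iff hJ hp (hq.2.2.pos hJ)]
    refine ⟨⟨le_trans (Nat.le_mul_of_pos_right _ (ell_pos hJ hp _)) hq.2.1, hq.2.2⟩, hq.2.1⟩
  · intro q _; rfl
  · intro q _; rfl
  · intro q _; rfl

theorem exists_abs_count_sub_le {q : ℕ → Prop} [DecidablePred q] {Q : ℕ} (hQ : 0 < Q)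
    (hq : Function.Periodic q Q) :
    ∃ δ B : ℝ, ∀ n : ℕ, |(Nat.count q n : ℝ) - δ * n| ≤ B := by
  have hQ' : (0 : ℝ) < Q := by exact_mod_cast hQ
  have hle : ∀ n, Nat.count q n ≤ n := fun n => Nat.count_le _
  refine ⟨Nat.count q Q / Q, Q, fun n => ?_⟩
  have hδ1 : (Nat.count q Q / Q : ℝ) ≤ 1 := by
    rw [div_le_one hQ']; exact_mod_cast hle Q
  have hδ0 : (0 : ℝ) ≤ Nat.count q Q / Q := by positivity
  have hper : Function.Periodic
      (fun n : ℕ => (Nat.count q n : ℝ) - Nat.count q Q / Q * n) Q := by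
    intro n
    have h1 : Nat.count q (n + Q) = Nat.count q n + Nat.count q Q := by
      rw [Nat.count_eq_card_filter_range q (n + Q), Nat.count_eq_card_filter_range q n,
        ← Nat.filter_Ico_card_eq_of_periodic n Q q hq, Finset.range_eq_Ico,
        ← Finset.Ico_union_Ico_eq_Ico (Nat.zero_le n) (Nat.le_add_right n Q), Finset.filter_union,
        Finset.card_union_of_disjoint, Finset.range_eq_Ico]
      exact Finset.disjoint_filter_filter (Finset.Ico_disjoint_Ico_consecutive 0 n (n + Q))
    simp only [h1]
    push_cast
    field_simp
    ring
  have h2 := hper.map_mod_nat n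
  rw [← h2]
  have h3 : ((n % Q : ℕ) : ℝ) ≤ Q := by exact_mod_cast (Nat.mod_lt n hQ).le
  have h4 : (Nat.count q (n % Q) : ℝ) ≤ (n % Q : ℕ) := by exact_mod_cast hle _
  have h5 : (0 : ℝ) ≤ Nat.count q (n % Q) := by positivity
  have h6 : (0 : ℝ) ≤ (n % Q : ℕ) := by positivity
  rw [abs_le]
  constructor <;> nlinarith

theorem isCore_periodic : Function.Periodic (IsCore p) (∏ j, p j) := by
  intro i
  simp only [IsCore, eq_iff_iff]
  refine forall_congr' fun j => not_congr ?_
  exact (Nat.dvd_add_iff_left (Finset.dvd_prod_of_mem p (Finset.mem_univ j))).symm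

theorem exists_abs_coreCount_sub_le (hp : ∀ j, (p j).Prime) :
    ∃ δ B : ℝ, ∀ n : ℕ, |(coreCount p n : ℝ) - δ * n| ≤ B := by
  classical
  obtain ⟨δ, B, h⟩ := exists_abs_count_sub_le (q := IsCore p)
    (Finset.prod_pos fun j _ => (hp j).pos) isCore_periodic
  refine ⟨δ, B + |δ|, fun n => ?_⟩
  have h1 := h (n + 1)
  rw [coreCount]
  calc |(Nat.count (IsCore p) (n + 1) : ℝ) - δ * n|
      = |((Nat.count (IsCore p) (n + 1) : ℝ) - δ * (n + 1 : ℕ)) + δ| := by push_cast; ring_nf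
    _ ≤ _ := (abs_add_le _ _).trans (by gcongr)

theorem tendsto_div_of_abs_sub_le {a : ℕ → ℝ} {c B : ℝ} (h : ∀ n : ℕ, |a n - c * n| ≤ B) :
    Tendsto (fun n => a n / n) atTop (𝓝 c) := by
  rw [tendsto_iff_norm_sub_tendsto_zero]
  refine squeeze_zero' (g := fun n : ℕ => B / n) (Eventually.of_forall fun n => norm_nonneg _) ?_
    (tendsto_const_div_atTop_nhds_zero_nat B)
  filter_upwards [eventually_gt_atTop 0] with n hn
  have hn' : (0 : ℝ) < n := by exact_mod_cast hn
  rw [Real.norm_eq_abs, le_div_iff₀ hn', ← abs_of_pos hn', ← abs_mul, abs_of_pos hn', sub_mul,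
    div_mul_cancel₀ _ hn'.ne']
  exact h n

theorem tendsto_coreCount_div_ell {δ B : ℝ} (hJ : 0 < J) (hp : ∀ j, (p j).Prime)
    (h : ∀ n : ℕ, |(coreCount p n : ℝ) - δ * n| ≤ B) (k : ℕ) :
    Tendsto (fun n : ℕ => (coreCount p (n / ell p k) : ℝ) / n) atTop (𝓝 (δ / ell p k)) := by
  refine tendsto_div_of_abs_sub_le (B := B + |δ|) fun n => ?_
  have hl := ell_pos_real hJ hp k
  have h1 : |((n / ell p k : ℕ) : ℝ) - n / ell p k| ≤ 1 := by
    have h2 : ((n / ell p k : ℕ) : ℝ) ≤ n / ell p k := Nat.cast_div_le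
    have h3 : (n / ell p k : ℝ) < (n / ell p k : ℕ) + 1 := by
      rw [div_lt_iff₀ hl]
      exact_mod_cast (Nat.lt_mul_of_div_lt (Nat.lt_add_one _) (ell_pos hJ hp k))
    rw [abs_le]; constructor <;> linarith
  calc |(coreCount p (n / ell p k) : ℝ) - δ / ell p k * n|
      = |((coreCount p (n / ell p k) : ℝ) - δ * (n / ell p k : ℕ)) +
          δ * ((n / ell p k : ℕ) - n / ell p k)| := by ring_nf
    _ ≤ _ := by
      refine (abs_add_le _ _).trans (add_le_add (h _) ?_)
      rw [abs_mul]
      exact mul_le_of_le_one_right (abs_nonneg _) h1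

theorem tendsto_sum_mul_coreCount_div {δ B : ℝ} (hJ : 0 < J) (hp : ∀ j, (p j).Prime)
    (hδ : ∀ n : ℕ, |(coreCount p n : ℝ) - δ * n| ≤ B) {h : ℕ → ℝ} {C : ℝ} (hC : ∀ k, |h k| ≤ C) :
    Tendsto (fun n : ℕ => (∑ k ∈ Finset.range (n + 1), h k * coreCount p (n / ell p k)) / n)
      atTop (𝓝 (δ * ∑' k, h k / ell p k)) := by
  have key : Tendsto (fun n : ℕ => ∑' k, h k * (coreCount p (n / ell p k) / n : ℝ)) atTop
      (𝓝 (∑' k, h k * (δ / ell p k))) := by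
    refine tendsto_tsum_of_dominated_convergence (bound := fun k => C * (1 / ell p k))
      ((summable_inv_ell hJ hp).mul_left C)
      (fun k => (tendsto_coreCount_div_ell hJ hp hδ k).const_mul _)
      (Eventually.of_forall fun n k => ?_)
    have hl := ell_pos_real hJ hp k
    have h0 : (0 : ℝ) ≤ coreCount p (n / ell p k) / n := by positivity
    rw [Real.norm_eq_abs, abs_mul, abs_of_nonneg h0]
    refine mul_le_mul (hC k) ?_ h0 ((abs_nonneg _).trans (hC k))
    rcases Nat.eq_zero_or_pos n with rfl | hn
    · simp
    have hn' : (0 : ℝ) < n := by exact_mod_cast hn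
    rw [div_le_iff₀ hn', div_mul_eq_mul_div, one_mul]
    calc (coreCount p (n / ell p k) : ℝ) ≤ (n / ell p k : ℕ) := by
          exact_mod_cast coreCount_le hJ _
      _ ≤ n / ell p k := Nat.cast_div_le
  have e1 : ∑' k, h k * (δ / ell p k) = δ * ∑' k, h k / ell p k := by
    rw [← tsum_mul_left]; exact tsum_congr fun k => by ring
  rw [← e1]
  refine key.congr fun n => ?_
  rw [tsum_eq_sum (s := Finset.range (n + 1)), Finset.sum_div]
  · exact Finset.sum_congr rfl fun k _ => by ring
  · intro k hk
    have h1 : n < k := by simpa using hk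
    have h2 := lt_ell hJ hp k
    rw [Nat.div_eq_of_lt (by omega), Nat.le_zero.1 (coreCount_le hJ 0)]
    simp

theorem tendsto_sum_idx_div {δ B : ℝ} (hJ : 0 < J) (hp : ∀ j, (p j).Prime)
    (hδ : ∀ n : ℕ, |(coreCount p n : ℝ) - δ * n| ≤ B) {h : ℕ → ℝ} {C : ℝ} (hC : ∀ k, |h k| ≤ C) :
    Tendsto (fun n : ℕ => (∑ r ∈ Finset.Icc 1 n, h (idx p r)) / n)
      atTop (𝓝 (δ * ∑' k, h k / ell p k)) := by
  refine (tendsto_sum_mul_coreCount_div hJ hp hδ hC).congr fun n => ?_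
  rw [sum_Icc_idx_eq hJ hp n fun _ k => h k]
  congr 1
  refine Finset.sum_congr rfl fun k _ => ?_
  rw [Finset.sum_const, card_coresUpTo, nsmul_eq_mul, mul_comm]

theorem gammaS_pos (hJ : 0 < J) (hp : ∀ j, (p j).Prime) : 0 < gammaS p :=
  (summable_inv_ell hJ hp).tsum_pos (fun k => by positivity) 0
    (by have := ell_pos_real hJ hp 0; positivity)

/-- The density of the cores is `1 / γ(S)`, with bounded discrepancy. -/
theorem abs_coreCount_sub_le (hJ : 0 < J) (hp : ∀ j, (p j).Prime) :
    ∃ B : ℝ, ∀ n : ℕ, |(coreCount p n : ℝ) - (gammaS p)⁻¹ * n| ≤ B := by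
  obtain ⟨δ, B, hδ⟩ := exists_abs_coreCount_sub_le hp
  have h1 := tendsto_sum_idx_div hJ hp hδ (h := fun _ => 1) (C := 1) (by simp)
  have h2 : Tendsto (fun n : ℕ => (∑ r ∈ Finset.Icc 1 n, (1 : ℝ)) / n) atTop (𝓝 1) := by
    refine tendsto_const_nhds.congr' ?_
    filter_upwards [eventually_gt_atTop 0] with n hn
    have hn' : (n : ℝ) ≠ 0 := by positivity
    simp [hn']
  have h3 : δ * gammaS p = 1 := tendsto_nhds_unique h1 h2
  rw [eq_inv_of_mul_eq_one_left h3] at hδ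
  exact ⟨B, hδ⟩

theorem tendsto_sum_idx_div_gammaS (hJ : 0 < J) (hp : ∀ j, (p j).Prime) {h : ℕ → ℝ} {C : ℝ}
    (hC : ∀ k, |h k| ≤ C) :
    Tendsto (fun n : ℕ => (∑ r ∈ Finset.Icc 1 n, h (idx p r)) / n)
      atTop (𝓝 ((gammaS p)⁻¹ * ∑' k, h k / ell p k)) := by
  obtain ⟨B, hB⟩ := abs_coreCount_sub_le hJ hp
  exact tendsto_sum_idx_div hJ hp hB hC

theorem one_div_ell_sub_pos (hJ : 0 < J) (hp : ∀ j, (p j).Prime) (k : ℕ) :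
    0 < 1 / (ell p k : ℝ) - 1 / (ell p (k + 1) : ℝ) := by
  have h1 := ell_pos_real hJ hp k
  have h2 : (ell p k : ℝ) < ell p (k + 1) := by
    exact_mod_cast ell_strictMono hJ hp (Nat.lt_add_one k)
  exact sub_pos.2 (one_div_lt_one_div_of_lt h1 h2)

theorem sum_mul_one_div_ell_sub {h : ℕ → ℝ} (h0 : h 0 = 0)
    (K : ℕ) :
    ∑ k ∈ Finset.range K, h (k + 1) * (1 / (ell p k : ℝ) - 1 / (ell p (k + 1) : ℝ)) =
      ∑ k ∈ Finset.range K, (h (k + 1) - h k) / ell p k - h K / ell p K := by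
  induction K with
  | zero => simp [h0]
  | succ K ih => rw [Finset.sum_range_succ, ih, Finset.sum_range_succ]; ring

theorem tendsto_nat_div_ell (hJ : 0 < J) (hp : ∀ j, (p j).Prime) :
    Tendsto (fun k : ℕ => (k : ℝ) / ell p k) atTop (𝓝 0) := by
  have hs := summable_inv_ell hJ hp
  have h1 : Tendsto (fun k : ℕ => 2 * (gammaS p - ∑ i ∈ Finset.range (k / 2), 1 / (ell p i : ℝ)))
      atTop (𝓝 0) := by
    have h2 := (hs.hasSum.tendsto_sum_nat).comp (Nat.tendsto_div_const_atTop (n := 2) (by norm_num))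
    have h3 := ((h2.const_sub (gammaS p)).const_mul 2)
    simpa [gammaS] using h3
  refine squeeze_zero (fun k => by positivity) (fun k => ?_) h1
  have h4 : ∑ i ∈ Finset.range k, 1 / (ell p i : ℝ) ≤ gammaS p :=
    hs.sum_le_tsum _ fun i _ => by positivity
  have h5 : ((k - k / 2 : ℕ) : ℝ) * (1 / ell p k) ≤
      ∑ i ∈ Finset.Ico (k / 2) k, 1 / (ell p i : ℝ) := by
    rw [← nsmul_eq_mul, ← Nat.card_Ico]
    refine Finset.card_nsmul_le_sum _ _ _ fun i hi => ?_
    exact one_div_le_one_div_of_le (ell_pos_real hJ hp i) (by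
      exact_mod_cast (ell_strictMono hJ hp).monotone (Finset.mem_Ico.1 hi).2.le)
  rw [Finset.sum_Ico_eq_sub _ (Nat.div_le_self k 2)] at h5
  have h6 : (k : ℝ) ≤ 2 * (k - k / 2 : ℕ) := by
    have : k ≤ 2 * (k - k / 2) := by omega
    exact_mod_cast this
  have h7 : (0 : ℝ) ≤ 1 / ell p k := by positivity
  calc (k : ℝ) / ell p k = k * (1 / ell p k) := by ring
    _ ≤ 2 * (k - k / 2 : ℕ) * (1 / ell p k) := by gcongr
    _ ≤ _ := by linarith

section Abel

variable {h : ℕ → ℝ} {C : ℝ}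

theorem summable_mul_one_div_ell_sub (hJ : 0 < J) (hp : ∀ j, (p j).Prime)
    (hn : ∀ k, 0 ≤ h k) (hC : ∀ k, h k ≤ C * k) :
    Summable fun k => h (k + 1) * (1 / (ell p k : ℝ) - 1 / (ell p (k + 1) : ℝ)) := by
  have hC0 : 0 ≤ C := by simpa using (hn 1).trans (hC 1)
  have hs : Summable fun k : ℕ =>
      ((k + 1 : ℕ) : ℝ) * (1 / (ell p k : ℝ) - 1 / (ell p (k + 1) : ℝ)) := by
    refine summable_of_sum_range_le (c := gammaS p)
      (fun k => mul_nonneg (by positivity) (one_div_ell_sub_pos hJ hp k).le) fun K => ?_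
    rw [sum_mul_one_div_ell_sub (h := fun k => (k : ℝ)) (by simp)]
    have h1 : ∑ k ∈ Finset.range K, (((k + 1 : ℕ) : ℝ) - k) / ell p k ≤ gammaS p := by
      refine le_trans (le_of_eq ?_)
        ((summable_inv_ell hJ hp).sum_le_tsum (Finset.range K) fun i _ => by positivity)
      exact Finset.sum_congr rfl fun k _ => by push_cast; ring
    have h2 : (0 : ℝ) ≤ K / ell p K := by positivity
    linarith
  refine Summable.of_nonneg_of_le
    (fun k => mul_nonneg (hn _) (one_div_ell_sub_pos hJ hp k).le) (fun k => ?_) (hs.mul_left C)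
  rw [← mul_assoc]
  exact mul_le_mul_of_nonneg_right (hC _) (one_div_ell_sub_pos hJ hp k).le

/-- Summation by parts. -/
theorem tendsto_sum_sub_div_ell (hJ : 0 < J) (hp : ∀ j, (p j).Prime) (h0 : h 0 = 0)
    (hn : ∀ k, 0 ≤ h k) (hC : ∀ k, h k ≤ C * k) :
    Tendsto (fun K => ∑ k ∈ Finset.range K, (h (k + 1) - h k) / ell p k) atTop
      (𝓝 (∑' k, h (k + 1) * (1 / (ell p k : ℝ) - 1 / (ell p (k + 1) : ℝ)))) := by
  have h1 := (summable_mul_one_div_ell_sub hJ hp hn hC).hasSum.tendsto_sum_nat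
  have h2 : Tendsto (fun K => h K / ell p K) atTop (𝓝 0) := by
    refine squeeze_zero (fun K => div_nonneg (hn K) (by positivity)) (fun K => ?_)
      (by simpa using (tendsto_nat_div_ell hJ hp).const_mul C)
    rw [← mul_div_assoc]
    exact div_le_div_of_nonneg_right (hC K) (by positivity)
  have h3 := h1.add h2
  rw [add_zero] at h3
  refine h3.congr fun K => ?_
  rw [sum_mul_one_div_ell_sub h0]
  ring

end Abel

end NumberTheory

namespace SymbolicSpace

variable {m : ℕ} {Ω : Set (SymbolicSpace m)} {k n : ℕ}

/-- The word of the first `k` digits. -/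
def pre (k : ℕ) (x : SymbolicSpace m) : Fin k → Fin m := fun i => x i

theorem pre_eq_iff {x y : SymbolicSpace m} : pre k x = pre k y ↔ ∀ i < k, x i = y i :=
  ⟨fun h i hi => congrFun h ⟨i, hi⟩, fun h => funext fun i => h i i.2⟩

theorem pre_eq_of_le {x y : SymbolicSpace m} (hkn : k ≤ n) (h : pre n x = pre n y) :
    pre k x = pre k y :=
  pre_eq_iff.2 fun i hi => pre_eq_iff.1 h i (hi.trans_le hkn)

theorem mem_cylinder {u : Fin k → Fin m} {x : SymbolicSpace m} : x ∈ cylinder u ↔ pre k x = u :=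
  ⟨fun h => funext h, fun h i => congrFun h i⟩

theorem mem_prefixes {u : Fin k → Fin m} : u ∈ prefixes Ω k ↔ ∃ x ∈ Ω, pre k x = u := by
  classical
  rw [prefixes, Finset.mem_filter]
  simp [Set.Nonempty, mem_cylinder]

theorem pre_mem_prefixes {x : SymbolicSpace m} (hx : x ∈ Ω) (k : ℕ) : pre k x ∈ prefixes Ω k :=
  mem_prefixes.2 ⟨x, hx, rfl⟩

theorem prefixes_nonempty (hne : Ω.Nonempty) (k : ℕ) : (prefixes Ω k).Nonempty :=
  let ⟨_, hx⟩ := hne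
  ⟨_, pre_mem_prefixes hx k⟩

theorem prefixes_zero (hne : Ω.Nonempty) : prefixes Ω 0 = {Fin.elim0} := by
  obtain ⟨u, hu⟩ := prefixes_nonempty hne 0
  ext v
  rw [Subsingleton.elim v u, Subsingleton.elim Fin.elim0 u]
  simp [hu]

theorem init_pre (k : ℕ) (x : SymbolicSpace m) :
    (Fin.init (pre (k + 1) x) : Fin k → Fin m) = pre k x := rfl

theorem snoc_pre (k : ℕ) (x : SymbolicSpace m) :
    (Fin.snoc (pre k x) (x k) : Fin (k + 1) → Fin m) = pre (k + 1) x := by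
  rw [← init_pre]
  exact Fin.snoc_init_self (α := fun _ => Fin m) (pre (k + 1) x)

theorem mem_continuations {u : Fin k → Fin m} {a : Fin m} :
    a ∈ continuations Ω u ↔ ∃ x ∈ Ω, pre k x = u ∧ x k = a := by
  classical
  rw [continuations, Finset.mem_filter, mem_prefixes]
  simp only [Finset.mem_univ, true_and]
  refine exists_congr fun x => and_congr_right fun _ => ?_
  rw [← snoc_pre, Fin.snoc_inj]

theorem mem_continuations_iff {u : Fin k → Fin m} {a : Fin m} :
    a ∈ continuations Ω u ↔ (Fin.snoc u a : Fin (k + 1) → Fin m) ∈ prefixes Ω (k + 1) := by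
  simp [continuations]

theorem digit_mem_continuations {x : SymbolicSpace m} (hx : x ∈ Ω) (k : ℕ) :
    x k ∈ continuations Ω (pre k x) :=
  mem_continuations.2 ⟨x, hx, rfl, rfl⟩

theorem continuations_nonempty {u : Fin k → Fin m} (hu : u ∈ prefixes Ω k) :
    (continuations Ω u).Nonempty := by
  obtain ⟨x, hx, rfl⟩ := mem_prefixes.1 hu
  exact ⟨_, digit_mem_continuations hx k⟩

theorem init_mem_prefixes {u : Fin (k + 1) → Fin m} (hu : u ∈ prefixes Ω (k + 1)) :
    (Fin.init u : Fin k → Fin m) ∈ prefixes Ω k := by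
  obtain ⟨x, hx, rfl⟩ := mem_prefixes.1 hu
  exact pre_mem_prefixes hx k

theorem sum_prefixes_succ {M : Type*} [AddCommMonoid M] (Ω : Set (SymbolicSpace m)) (k : ℕ)
    (f : (Fin (k + 1) → Fin m) → M) :
    ∑ v ∈ prefixes Ω (k + 1), f v =
      ∑ u ∈ prefixes Ω k, ∑ a ∈ continuations Ω u, f (Fin.snoc u a) := by
  rw [Finset.sum_sigma']
  refine Finset.sum_bij' (fun v _ => ⟨Fin.init v, v (Fin.last k)⟩) (fun q _ => Fin.snoc q.1 q.2)
    ?_ ?_ ?_ ?_ ?_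
  · intro v hv
    rw [Finset.mem_sigma, mem_continuations_iff]
    refine ⟨init_mem_prefixes hv, ?_⟩
    simpa using hv
  · intro q hq
    exact mem_continuations_iff.1 (Finset.mem_sigma.1 hq).2
  · intro v _
    simp
  · intro q _
    simp
  · intro v _
    simp

theorem card_prefixes_succ (Ω : Set (SymbolicSpace m)) (k : ℕ) :
    (prefixes Ω (k + 1)).card = ∑ u ∈ prefixes Ω k, (continuations Ω u).card := by
  rw [Finset.card_eq_sum_ones, sum_prefixes_succ]
  simp

theorem card_continuations_le (u : Fin k → Fin m) : (continuations Ω u).card ≤ m := by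
  simpa using Finset.card_le_univ (continuations Ω u)

theorem card_prefixes_succ_le (Ω : Set (SymbolicSpace m)) (k : ℕ) :
    (prefixes Ω (k + 1)).card ≤ (prefixes Ω k).card * m := by
  rw [card_prefixes_succ, ← smul_eq_mul]
  exact Finset.sum_le_card_nsmul _ _ _ fun u _ => card_continuations_le u

theorem card_prefixes_le_succ (Ω : Set (SymbolicSpace m)) (k : ℕ) :
    (prefixes Ω k).card ≤ (prefixes Ω (k + 1)).card := by
  rw [card_prefixes_succ, Finset.card_eq_sum_ones]
  exact Finset.sum_le_sum fun u hu => (continuations_nonempty hu).card_pos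

theorem card_prefixes_pos (hne : Ω.Nonempty) (k : ℕ) : 0 < (prefixes Ω k).card :=
  (prefixes_nonempty hne k).card_pos

section Metric

theorem le_firstDiff_iff {x y : SymbolicSpace m} (hne : x ≠ y) :
    n ≤ PiNat.firstDiff x.digit y.digit ↔ pre n x = pre n y := by
  rw [pre_eq_iff]
  constructor
  · intro h i hi
    exact PiNat.apply_eq_of_lt_firstDiff (hi.trans_le h)
  · intro h
    by_contra hlt
    have hne' : x.digit ≠ y.digit := fun e => hne (SymbolicSpace.ext e)
    exact PiNat.apply_firstDiff_ne hne' (h _ (not_le.1 hlt))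

theorem dist_le_of_pre_eq {x y : SymbolicSpace m} (hm : 2 ≤ m) (h : pre n x = pre n y) :
    dist x y ≤ ((m : ℝ)⁻¹) ^ (n + 1) := by
  have hm1 : (1 : ℝ) ≤ m := by exact_mod_cast (by omega : 1 ≤ m)
  by_cases hxy : x = y
  · rw [hxy, dist_self]; positivity
  · rw [dist_of_ne hxy]
    exact pow_le_pow_of_le_one (by positivity) (inv_le_one_of_one_le₀ hm1)
      (Nat.succ_le_succ ((le_firstDiff_iff hxy).2 h))

theorem pre_eq_of_dist_lt {x y : SymbolicSpace m} (hm : 2 ≤ m)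
    (h : dist x y < ((m : ℝ)⁻¹) ^ n) : pre n x = pre n y := by
  have hm1 : (1 : ℝ) < m := by exact_mod_cast (by omega : 1 < m)
  by_cases hxy : x = y
  · rw [hxy]
  · rw [dist_of_ne hxy, pow_lt_pow_iff_right_of_lt_one₀ (by positivity) (inv_lt_one_of_one_lt₀ hm1)]
      at h
    exact (le_firstDiff_iff hxy).1 (Nat.lt_succ_iff.1 h)

theorem isOpen_cylinder (hm : 2 ≤ m) (u : Fin k → Fin m) : IsOpen (cylinder u) := by
  rw [Metric.isOpen_iff]
  intro x hx
  refine ⟨((m : ℝ)⁻¹) ^ k, by positivity, fun y hy => ?_⟩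
  rw [mem_cylinder] at hx ⊢
  rw [← hx]
  exact pre_eq_of_dist_lt hm hy

theorem measurableSet_cylinder (hm : 2 ≤ m) (u : Fin k → Fin m) : MeasurableSet (cylinder u) :=
  (isOpen_cylinder hm u).measurableSet

theorem measurable_pre (hm : 2 ≤ m) (k : ℕ) : Measurable (pre k : SymbolicSpace m → _) := by
  refine measurable_to_countable' fun u => ?_
  convert measurableSet_cylinder hm u using 1
  ext x
  simp [mem_cylinder]

theorem isOpen_eq_iUnion_cylinder (hm : 2 ≤ m) {U : Set (SymbolicSpace m)} (hU : IsOpen U) :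
    U = ⋃ (n : ℕ) (u : Fin n → Fin m) (_ : cylinder u ⊆ U), cylinder u := by
  refine Set.Subset.antisymm (fun x hx => ?_) (Set.iUnion_subset fun n => Set.iUnion_subset
    fun u => Set.iUnion_subset fun h => h)
  obtain ⟨ε, hε, hb⟩ := Metric.isOpen_iff.1 hU x hx
  have hm1 : (1 : ℝ) < m := by exact_mod_cast (by omega : 1 < m)
  obtain ⟨n, hn⟩ := exists_pow_lt_of_lt_one hε (inv_lt_one_of_one_lt₀ hm1)
  simp only [Set.mem_iUnion]
  refine ⟨n, pre n x, fun y hy => hb ?_, mem_cylinder.2 rfl⟩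
  refine lt_of_le_of_lt (dist_le_of_pre_eq hm (mem_cylinder.1 hy)) (lt_of_le_of_lt ?_ hn)
  exact pow_le_pow_of_le_one (by positivity) (inv_lt_one_of_one_lt₀ hm1).le (Nat.le_succ n)

theorem measurable_of_digits (hm : 2 ≤ m) {α : Type*} [MeasurableSpace α] {f : α → SymbolicSpace m}
    (hf : ∀ k, Measurable fun a => f a k) : Measurable f := by
  refine measurable_of_isOpen fun U hU => ?_
  rw [isOpen_eq_iUnion_cylinder hm hU, Set.preimage_iUnion]
  refine MeasurableSet.iUnion fun n => ?_
  rw [Set.preimage_iUnion]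
  refine MeasurableSet.iUnion fun u => ?_
  rw [Set.preimage_iUnion]
  refine MeasurableSet.iUnion fun _ => ?_
  have : f ⁻¹' cylinder u = ⋂ i : Fin n, (fun a => f a i) ⁻¹' {u i} := by
    ext a
    simp [cylinder]
  rw [this]
  exact MeasurableSet.iInter fun i => hf i (measurableSet_singleton _)

theorem measurable_digit (hm : 2 ≤ m) (k : ℕ) : Measurable fun x : SymbolicSpace m => x k :=
  (measurable_pi_apply (Fin.last k)).comp (measurable_pre hm (k + 1))

end Metric

section Fractal

variable {J : ℕ} {p : Fin J → ℕ}

/-- The sequence whose restriction to the chain of the core `i` is `ω i`. -/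
def glue (p : Fin J → ℕ) (ω : ℕ → SymbolicSpace m) : SymbolicSpace m :=
  ⟨fun q => ω (core p (q + 1)) (idx p (q + 1))⟩

theorem restrict_glue (hJ : 0 < J) (hp : ∀ j, (p j).Prime) (ω : ℕ → SymbolicSpace m) {i : ℕ}
    (hi : IsCore p i) : restrict p i (glue p ω) = ω i := by
  ext k
  have h : i * ell p k - 1 + 1 = i * ell p k :=
    Nat.sub_add_cancel (Nat.mul_pos (hi.pos hJ) (ell_pos hJ hp k))
  simp only [restrict, glue, h, core_mul hJ hp hi, idx_mul hJ hp hi]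

theorem restrict_core_idx (hp : ∀ j, (p j).Prime) (x : SymbolicSpace m) (q : ℕ) :
    restrict p (core p (q + 1)) x (idx p (q + 1)) = x q := by
  simp only [restrict, core_mul_ell hp (Nat.add_one_pos q), Nat.add_sub_cancel]

theorem mem_fractal_iff (hJ : 0 < J) {x : SymbolicSpace m} :
    x ∈ fractal p Ω ↔ ∀ i, IsCore p i → restrict p i x ∈ Ω :=
  ⟨fun h i hi => h i (hi.pos hJ) hi, fun h i _ hi => h i hi⟩

theorem glue_mem_fractal (hJ : 0 < J) (hp : ∀ j, (p j).Prime) {ω : ℕ → SymbolicSpace m}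
    (hω : ∀ i, ω i ∈ Ω) : glue p ω ∈ fractal p Ω :=
  (mem_fractal_iff hJ).2 fun i hi => by rw [restrict_glue hJ hp ω hi]; exact hω i

theorem pre_eq_iff_restrict (hJ : 0 < J) (hp : ∀ j, (p j).Prime) {x y : SymbolicSpace m} :
    pre n x = pre n y ↔ ∀ i ∈ coresUpTo p n,
      pre (chainLen p n i) (restrict p i x) = pre (chainLen p n i) (restrict p i y) := by
  constructor
  · intro h i hi
    have hi0 := (mem_coresUpTo.1 hi).2.pos hJ
    refine pre_eq_iff.2 fun k hk => ?_
    rw [lt_chainLen_iff hJ hp hi0] at hk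
    have := Nat.mul_pos hi0 (ell_pos hJ hp k)
    exact pre_eq_iff.1 h (i * ell p k - 1) (by omega)
  · intro h
    refine pre_eq_iff.2 fun q hq => ?_
    have h1 := coreIdx_spec hp (Nat.succ_pos q)
    have h2 : core p (q + 1) * ell p (idx p (q + 1)) ≤ n := by rw [h1.2]; exact hq
    have h3 : core p (q + 1) ∈ coresUpTo p n :=
      mem_coresUpTo.2 ⟨(Nat.le_mul_of_pos_right _ (ell_pos hJ hp _)).trans h2, h1.1⟩
    rw [← restrict_core_idx hp x, ← restrict_core_idx hp y]
    exact pre_eq_iff.1 (h _ h3) _ ((lt_chainLen_iff hJ hp (h1.1.pos hJ)).2 h2)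

end Fractal

end SymbolicSpace

section Entropy

variable {ι : Type*}

theorem negMulLog_le_mul_log_add {w N : ℝ} (hw : 0 ≤ w) (hN : 0 < N) :
    Real.negMulLog w ≤ w * Real.log N + (1 / N - w) := by
  rcases hw.eq_or_lt with rfl | hw'
  · simp [hN.le]
  · have h1 := Real.log_le_sub_one_of_pos (show 0 < 1 / (w * N) by positivity)
    rw [one_div, Real.log_inv, Real.log_mul hw'.ne' hN.ne'] at h1
    have h2 := mul_le_mul_of_nonneg_left h1 hw
    have h3 : w * ((w * N)⁻¹ - 1) = 1 / N - w := by field_simp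
    rw [h3] at h2
    rw [Real.negMulLog]
    linarith

theorem negMulLog_lt_mul_log_add {w N : ℝ} (hw : 0 ≤ w) (hN : 0 < N) (hne : w ≠ 1 / N) :
    Real.negMulLog w < w * Real.log N + (1 / N - w) := by
  rcases hw.eq_or_lt with rfl | hw'
  · simp [hN]
  · have hne' : 1 / (w * N) ≠ 1 := by
      intro h
      apply hne
      field_simp at h ⊢
      linarith
    have h1 := Real.log_lt_sub_one_of_pos (show 0 < 1 / (w * N) by positivity) hne'
    rw [one_div, Real.log_inv, Real.log_mul hw'.ne' hN.ne'] at h1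
    have h2 := mul_lt_mul_of_pos_left h1 hw'
    have h3 : w * ((w * N)⁻¹ - 1) = 1 / N - w := by field_simp
    rw [h3] at h2
    rw [Real.negMulLog]
    linarith

theorem sum_mul_log_card_add {s : Finset ι} {w : ι → ℝ} (h1 : ∑ i ∈ s, w i = 1) :
    ∑ i ∈ s, (w i * Real.log s.card + (1 / s.card - w i)) = Real.log s.card := by
  have hs : (s.card : ℝ) ≠ 0 := by
    intro h
    rw [Nat.cast_eq_zero, Finset.card_eq_zero] at h
    simp [h] at h1
  rw [Finset.sum_add_distrib, ← Finset.sum_mul, Finset.sum_sub_distrib, h1, Finset.sum_const,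
    nsmul_eq_mul]
  field_simp
  ring

theorem card_pos_of_sum_eq_one {s : Finset ι} {w : ι → ℝ} (h1 : ∑ i ∈ s, w i = 1) :
    (0 : ℝ) < s.card := by
  rcases s.eq_empty_or_nonempty with rfl | h
  · simp at h1
  · exact_mod_cast h.card_pos

/-- The entropy of a probability vector is at most the logarithm of its length. -/
theorem sum_negMulLog_le_log_card {s : Finset ι} {w : ι → ℝ} (h0 : ∀ i ∈ s, 0 ≤ w i)
    (h1 : ∑ i ∈ s, w i = 1) : ∑ i ∈ s, Real.negMulLog (w i) ≤ Real.log s.card := by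
  rw [← sum_mul_log_card_add h1]
  exact Finset.sum_le_sum fun i hi => negMulLog_le_mul_log_add (h0 i hi) (card_pos_of_sum_eq_one h1)

theorem eq_of_sum_negMulLog_eq_log_card {s : Finset ι} {w : ι → ℝ} (h0 : ∀ i ∈ s, 0 ≤ w i)
    (h1 : ∑ i ∈ s, w i = 1) (h : ∑ i ∈ s, Real.negMulLog (w i) = Real.log s.card) :
    ∀ i ∈ s, w i = 1 / s.card := by
  by_contra! hne
  obtain ⟨i, hi, hne⟩ := hne
  have hc := card_pos_of_sum_eq_one h1
  have := Finset.sum_lt_sum (fun i hi => negMulLog_le_mul_log_add (h0 i hi) hc)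
    ⟨i, hi, negMulLog_lt_mul_log_add (h0 i hi) hc hne⟩
  rw [sum_mul_log_card_add h1] at this
  exact this.ne h

end Entropy

namespace SymbolicSpace

variable {m J : ℕ} {p : Fin J → ℕ} {Ω : Set (SymbolicSpace m)} {k : ℕ}

/-- The approximation to the potential which looks `d` levels ahead in the tree of prefixes. -/
def potTrunc (p : Fin J → ℕ) (Ω : Set (SymbolicSpace m)) : ℕ → ∀ k, (Fin k → Fin m) → ℝ
  | 0, _, _ => 0
  | d + 1, k, u => (ell p k : ℝ)⁻¹ * Real.log (∑ a ∈ continuations Ω u,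
      Real.exp (ell p k * potTrunc p Ω d (k + 1) (Fin.snoc u a)))

/-- The potential `τ` on the tree of prefixes: it solves
`exp (ℓ τ u) = ∑ a, exp (ℓ τ (u a))` with `ℓ = ell p k` for words `u` of length `k`. -/
def pot (p : Fin J → ℕ) (Ω : Set (SymbolicSpace m)) (k : ℕ) (u : Fin k → Fin m) : ℝ :=
  ⨆ d, potTrunc p Ω d k u

theorem potTrunc_nonneg (d k : ℕ) (u : Fin k → Fin m) : 0 ≤ potTrunc p Ω d k u := by
  induction d generalizing k with
  | zero => exact le_rfl
  | succ d ih =>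
    refine mul_nonneg (by positivity) ?_
    rcases (continuations Ω u).eq_empty_or_nonempty with h | ⟨a, ha⟩
    · simp [h]
    · refine Real.log_nonneg ?_
      refine le_trans ?_ (Finset.single_le_sum (fun b _ => (Real.exp_pos _).le) ha)
      exact Real.one_le_exp (mul_nonneg (by positivity) (ih _ _))

theorem potTrunc_le_succ (d k : ℕ) (u : Fin k → Fin m) :
    potTrunc p Ω d k u ≤ potTrunc p Ω (d + 1) k u := by
  induction d generalizing k with
  | zero => exact potTrunc_nonneg 1 k u
  | succ d ih =>
    refine mul_le_mul_of_nonneg_left ?_ (by positivity)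
    rcases (continuations Ω u).eq_empty_or_nonempty with h | h
    · simp [h]
    · refine Real.log_le_log (Finset.sum_pos (fun b _ => Real.exp_pos _) h) ?_
      refine Finset.sum_le_sum fun a _ => Real.exp_le_exp.2 ?_
      exact mul_le_mul_of_nonneg_left (ih _ _) (by positivity)

theorem potTrunc_mono (k : ℕ) (u : Fin k → Fin m) : Monotone fun d => potTrunc p Ω d k u :=
  monotone_nat_of_le_succ fun d => potTrunc_le_succ d k u

theorem potTrunc_le_sum (hm : 2 ≤ m) (hJ : 0 < J) (hp : ∀ j, (p j).Prime) (d k : ℕ)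
    (u : Fin k → Fin m) :
    potTrunc p Ω d k u ≤ Real.log m * ∑ j ∈ Finset.range d, 1 / (ell p (j + k) : ℝ) := by
  have hlm : 0 ≤ Real.log m := Real.log_natCast_nonneg m
  have hm0 : (0 : ℝ) < m := by exact_mod_cast (by omega : 0 < m)
  induction d generalizing k with
  | zero => simp [potTrunc]
  | succ d ih =>
    have hl := ell_pos_real hJ hp k
    rw [Finset.sum_range_succ']
    set R := ∑ j ∈ Finset.range d, 1 / (ell p (j + 1 + k) : ℝ) with hR
    have hR' : R = ∑ j ∈ Finset.range d, 1 / (ell p (j + (k + 1)) : ℝ) :=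
      Finset.sum_congr rfl fun j _ => by rw [add_assoc, add_comm 1 k]
    have hR0 : 0 ≤ R := Finset.sum_nonneg fun j _ => by positivity
    rw [zero_add, potTrunc]
    rcases (continuations Ω u).eq_empty_or_nonempty with h | h
    · simp only [h, Finset.sum_empty, Real.log_zero, mul_zero]
      positivity
    · have h1 : ∑ a ∈ continuations Ω u,
          Real.exp (ell p k * potTrunc p Ω d (k + 1) (Fin.snoc u a)) ≤
          m * Real.exp (ell p k * (Real.log m * R)) := by
        refine (Finset.sum_le_card_nsmul _ _ (Real.exp (ell p k * (Real.log m * R)))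
          fun a _ => ?_).trans ?_
        · refine Real.exp_le_exp.2 (mul_le_mul_of_nonneg_left ?_ hl.le)
          rw [hR']
          exact ih _ _
        · rw [nsmul_eq_mul]
          gcongr
          exact card_continuations_le u
      have h2 := Real.log_le_log (Finset.sum_pos (fun b _ => Real.exp_pos _) h) h1
      rw [Real.log_mul hm0.ne' (Real.exp_pos _).ne', Real.log_exp] at h2
      calc _ ≤ (ell p k : ℝ)⁻¹ * (Real.log m + ell p k * (Real.log m * R)) := by gcongr
        _ = _ := by field_simp; ring

theorem potTrunc_le (hm : 2 ≤ m) (hJ : 0 < J) (hp : ∀ j, (p j).Prime) (d k : ℕ)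
    (u : Fin k → Fin m) :
    potTrunc p Ω d k u ≤ Real.log m * ∑' j, 1 / (ell p (j + k) : ℝ) := by
  refine (potTrunc_le_sum hm hJ hp d k u).trans ?_
  refine mul_le_mul_of_nonneg_left ?_ (Real.log_natCast_nonneg m)
  exact ((summable_nat_add_iff k).2 (summable_inv_ell hJ hp)).sum_le_tsum _
    fun j _ => by positivity

theorem tendsto_potTrunc (hm : 2 ≤ m) (hJ : 0 < J) (hp : ∀ j, (p j).Prime) (k : ℕ)
    (u : Fin k → Fin m) : Tendsto (fun d => potTrunc p Ω d k u) atTop (𝓝 (pot p Ω k u)) :=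
  tendsto_atTop_ciSup (potTrunc_mono k u)
    ⟨_, Set.forall_mem_range.2 fun d => potTrunc_le hm hJ hp d k u⟩

theorem pot_nonneg (hm : 2 ≤ m) (hJ : 0 < J) (hp : ∀ j, (p j).Prime) (k : ℕ) (u : Fin k → Fin m) :
    0 ≤ pot p Ω k u :=
  ge_of_tendsto' (tendsto_potTrunc hm hJ hp k u) fun d => potTrunc_nonneg d k u

theorem pot_le (hm : 2 ≤ m) (hJ : 0 < J) (hp : ∀ j, (p j).Prime) (k : ℕ) (u : Fin k → Fin m) :
    pot p Ω k u ≤ Real.log m * ∑' j, 1 / (ell p (j + k) : ℝ) :=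
  le_of_tendsto' (tendsto_potTrunc hm hJ hp k u) fun d => potTrunc_le hm hJ hp d k u

theorem exp_mul_pot (hm : 2 ≤ m) (hJ : 0 < J) (hp : ∀ j, (p j).Prime) {u : Fin k → Fin m}
    (hu : u ∈ prefixes Ω k) :
    ∑ a ∈ continuations Ω u, Real.exp (ell p k * pot p Ω (k + 1) (Fin.snoc u a)) =
      Real.exp (ell p k * pot p Ω k u) := by
  have h1 : Tendsto (fun d => ∑ a ∈ continuations Ω u,
      Real.exp (ell p k * potTrunc p Ω d (k + 1) (Fin.snoc u a))) atTop
      (𝓝 (∑ a ∈ continuations Ω u, Real.exp (ell p k * pot p Ω (k + 1) (Fin.snoc u a)))) :=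
    tendsto_finsetSum _ fun a _ => (Real.continuous_exp.tendsto _).comp
      ((tendsto_potTrunc hm hJ hp (k + 1) _).const_mul _)
  have h2 := (Real.continuous_exp.tendsto _).comp
    (((tendsto_add_atTop_iff_nat 1).2 (tendsto_potTrunc (Ω := Ω) hm hJ hp k u)).const_mul
      (ell p k : ℝ))
  refine tendsto_nhds_unique h1 (h2.congr fun d => ?_)
  have hl := ell_pos_real hJ hp k
  rw [Function.comp_apply, potTrunc, mul_inv_cancel_left₀ hl.ne', Real.exp_log]
  exact Finset.sum_pos (fun b _ => Real.exp_pos _) (continuations_nonempty hu)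

/-- The mass which the optimal measure gives to the cylinder of a prefix `u`. -/
def weight (p : Fin J → ℕ) (Ω : Set (SymbolicSpace m)) : ∀ k, (Fin k → Fin m) → ℝ
  | 0, _ => 1
  | k + 1, u => weight p Ω k (Fin.init u) *
      Real.exp (ell p k * (pot p Ω (k + 1) u - pot p Ω k (Fin.init u)))

theorem weight_pos (k : ℕ) (u : Fin k → Fin m) : 0 < weight p Ω k u := by
  induction k with
  | zero => exact one_pos
  | succ k ih => exact mul_pos (ih _) (Real.exp_pos _)

theorem sum_weight_snoc (hm : 2 ≤ m) (hJ : 0 < J) (hp : ∀ j, (p j).Prime) {u : Fin k → Fin m}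
    (hu : u ∈ prefixes Ω k) :
    ∑ a ∈ continuations Ω u, weight p Ω (k + 1) (Fin.snoc u a) = weight p Ω k u := by
  simp only [weight, Fin.init_snoc]
  rw [← Finset.mul_sum]
  simp only [mul_sub, Real.exp_sub]
  rw [← Finset.sum_div, exp_mul_pot hm hJ hp hu, div_self (Real.exp_pos _).ne', mul_one]

theorem sum_weight_mul_init (hm : 2 ≤ m) (hJ : 0 < J) (hp : ∀ j, (p j).Prime) (k : ℕ)
    (F : (Fin k → Fin m) → ℝ) :
    ∑ v ∈ prefixes Ω (k + 1), weight p Ω (k + 1) v * F (Fin.init v) =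
      ∑ u ∈ prefixes Ω k, weight p Ω k u * F u := by
  rw [sum_prefixes_succ]
  refine Finset.sum_congr rfl fun u hu => ?_
  simp only [Fin.init_snoc]
  rw [← Finset.sum_mul, sum_weight_snoc hm hJ hp hu]

theorem sum_weight (hm : 2 ≤ m) (hJ : 0 < J) (hp : ∀ j, (p j).Prime) (hne : Ω.Nonempty) (k : ℕ) :
    ∑ u ∈ prefixes Ω k, weight p Ω k u = 1 := by
  induction k with
  | zero => simp [prefixes_zero hne, weight]
  | succ k ih => simpa [ih] using sum_weight_mul_init (Ω := Ω) hm hJ hp k fun _ => 1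

def weightEntropy (p : Fin J → ℕ) (Ω : Set (SymbolicSpace m)) (k : ℕ) : ℝ :=
  ∑ u ∈ prefixes Ω k, Real.negMulLog (weight p Ω k u)

def meanPot (p : Fin J → ℕ) (Ω : Set (SymbolicSpace m)) (k : ℕ) : ℝ :=
  ∑ u ∈ prefixes Ω k, weight p Ω k u * pot p Ω k u

theorem weightEntropy_succ (hm : 2 ≤ m) (hJ : 0 < J) (hp : ∀ j, (p j).Prime) (k : ℕ) :
    weightEntropy p Ω (k + 1) =
      weightEntropy p Ω k + ell p k * (meanPot p Ω k - meanPot p Ω (k + 1)) := by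
  have h1 := sum_weight_mul_init (Ω := Ω) hm hJ hp k fun u => Real.log (weight p Ω k u)
  have h2 := sum_weight_mul_init (Ω := Ω) hm hJ hp k fun u => pot p Ω k u
  simp only [weightEntropy, meanPot, Real.negMulLog, neg_mul, Finset.sum_neg_distrib]
  rw [← h1, ← h2, mul_sub, Finset.mul_sum, Finset.mul_sum, ← sub_eq_zero]
  simp only [← Finset.sum_neg_distrib, ← Finset.sum_sub_distrib, ← Finset.sum_add_distrib]
  refine Finset.sum_eq_zero fun v _ => ?_
  have h3 : Real.log (weight p Ω (k + 1) v) = Real.log (weight p Ω k (Fin.init v)) +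
      ell p k * (pot p Ω (k + 1) v - pot p Ω k (Fin.init v)) := by
    rw [weight, Real.log_mul (weight_pos _ _).ne' (Real.exp_pos _).ne', Real.log_exp]
  rw [h3]
  ring

theorem log_card_prefixes_le (hne : Ω.Nonempty) (k : ℕ) :
    Real.log (prefixes Ω k).card ≤ Real.log m * k := by
  have h : (prefixes Ω k).card ≤ m ^ k := by
    induction k with
    | zero => simp [prefixes_zero hne]
    | succ k ih => exact (card_prefixes_succ_le Ω k).trans (Nat.mul_le_mul_right m ih)
  have hc : (0 : ℝ) < (prefixes Ω k).card := by exact_mod_cast card_prefixes_pos hne k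
  calc Real.log (prefixes Ω k).card ≤ Real.log ((m : ℝ) ^ k) :=
        Real.log_le_log hc (by exact_mod_cast h)
    _ = _ := by rw [Real.log_pow, mul_comm]

theorem weightEntropy_le_log_card (hm : 2 ≤ m) (hJ : 0 < J) (hp : ∀ j, (p j).Prime)
    (hne : Ω.Nonempty) (k : ℕ) : weightEntropy p Ω k ≤ Real.log (prefixes Ω k).card :=
  sum_negMulLog_le_log_card (fun u _ => (weight_pos k u).le) (sum_weight hm hJ hp hne k)

theorem weightEntropy_nonneg (hm : 2 ≤ m) (hJ : 0 < J) (hp : ∀ j, (p j).Prime)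
    (hne : Ω.Nonempty) (k : ℕ) : 0 ≤ weightEntropy p Ω k := by
  refine Finset.sum_nonneg fun u hu => Real.negMulLog_nonneg (weight_pos k u).le ?_
  rw [← sum_weight hm hJ hp hne k]
  exact Finset.single_le_sum (fun v _ => (weight_pos k v).le) hu

theorem weightEntropy_zero (hne : Ω.Nonempty) : weightEntropy p Ω 0 = 0 := by
  simp [weightEntropy, prefixes_zero hne, weight]

theorem tendsto_meanPot (hm : 2 ≤ m) (hJ : 0 < J) (hp : ∀ j, (p j).Prime) (hne : Ω.Nonempty) :
    Tendsto (meanPot p Ω) atTop (𝓝 0) := by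
  have h := (tendsto_sum_nat_add fun k => 1 / (ell p k : ℝ)).const_mul (Real.log m)
  rw [mul_zero] at h
  refine squeeze_zero (fun k => Finset.sum_nonneg fun u _ =>
    mul_nonneg (weight_pos k u).le (pot_nonneg hm hJ hp k u)) (fun k => ?_) h
  calc meanPot p Ω k ≤ ∑ u ∈ prefixes Ω k,
        weight p Ω k u * (Real.log m * ∑' j, 1 / (ell p (j + k) : ℝ)) :=
        Finset.sum_le_sum fun u _ =>
          mul_le_mul_of_nonneg_left (pot_le hm hJ hp k u) (weight_pos k u).le
    _ = _ := by rw [← Finset.sum_mul, sum_weight hm hJ hp hne, one_mul]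

theorem summable_weightEntropy (hm : 2 ≤ m) (hJ : 0 < J) (hp : ∀ j, (p j).Prime)
    (hne : Ω.Nonempty) : Summable fun k => weightEntropy p Ω (k + 1) *
      (1 / (ell p k : ℝ) - 1 / (ell p (k + 1) : ℝ)) :=
  summable_mul_one_div_ell_sub hJ hp (weightEntropy_nonneg hm hJ hp hne)
    fun k => (weightEntropy_le_log_card hm hJ hp hne k).trans (log_card_prefixes_le hne k)

/-- The optimal entropy sum is the potential of the root. -/
theorem tsum_weightEntropy (hm : 2 ≤ m) (hJ : 0 < J) (hp : ∀ j, (p j).Prime) (hne : Ω.Nonempty) :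
    ∑' k, weightEntropy p Ω (k + 1) * (1 / (ell p k : ℝ) - 1 / (ell p (k + 1) : ℝ)) =
      pot p Ω 0 Fin.elim0 := by
  have h1 := tendsto_sum_sub_div_ell hJ hp (weightEntropy_zero hne)
    (weightEntropy_nonneg hm hJ hp hne)
    fun k => (weightEntropy_le_log_card hm hJ hp hne k).trans (log_card_prefixes_le hne k)
  refine tendsto_nhds_unique h1 ?_
  have h2 : meanPot p Ω 0 = pot p Ω 0 Fin.elim0 := by
    simp [meanPot, prefixes_zero hne, weight]
  have h3 := (tendsto_meanPot hm hJ hp hne).const_sub (meanPot p Ω 0)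
  rw [sub_zero, h2] at h3
  refine h3.congr fun K => ?_
  rw [← h2, ← Finset.sum_range_sub']
  refine Finset.sum_congr rfl fun k _ => ?_
  have hl := ell_pos_real hJ hp k
  rw [weightEntropy_succ hm hJ hp, add_sub_cancel_left, mul_div_cancel_left₀ _ hl.ne']

section Measure

variable (μ : Measure Ω)

theorem measurableSet_coe_cylinder (hm : 2 ≤ m) (u : Fin k → Fin m) :
    MeasurableSet {x : Ω | x.1 ∈ cylinder u} :=
  measurable_subtype_coe (measurableSet_cylinder hm u)

theorem sum_measureReal_snoc [IsProbabilityMeasure μ] (hm : 2 ≤ m) (u : Fin k → Fin m) :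
    ∑ a ∈ continuations Ω u,
      μ.real {x : Ω | x.1 ∈ cylinder (Fin.snoc u a : Fin (k + 1) → Fin m)} =
      μ.real {x : Ω | x.1 ∈ cylinder u} := by
  rw [← measureReal_biUnion_finset]
  · congr 1
    ext x
    simp only [Set.mem_iUnion, Set.mem_ofPred_eq, mem_cylinder, ← snoc_pre, Fin.snoc_inj]
    constructor
    · rintro ⟨a, _, h, _⟩
      exact h
    · rintro rfl
      exact ⟨_, digit_mem_continuations x.2 k, rfl, rfl⟩
  · intro a _ b _ hab
    refine Set.disjoint_left.2 fun x hx hy => hab ?_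
    simp only [Set.mem_ofPred_eq, mem_cylinder] at hx hy
    exact ((Fin.snoc_inj (α := fun _ => Fin m)).1 (hx.symm.trans hy)).2
  · exact fun a _ => measurableSet_coe_cylinder hm _

theorem measureReal_cylinder_eq_zero {u : Fin k → Fin m} (hu : u ∉ prefixes Ω k) :
    μ.real {x : Ω | x.1 ∈ cylinder u} = 0 := by
  have : {x : Ω | x.1 ∈ cylinder u} = ∅ := by
    ext x
    simp only [Set.mem_ofPred_eq, mem_cylinder, Set.mem_empty_iff_false, iff_false]
    rintro rfl
    exact hu (pre_mem_prefixes x.2 k)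
  rw [this, measureReal_empty]

theorem integral_pre [IsProbabilityMeasure μ] (hm : 2 ≤ m) (k : ℕ) (F : (Fin k → Fin m) → ℝ) :
    ∫ x : Ω, F (pre k x.1) ∂μ =
      ∑ u ∈ prefixes Ω k, μ.real {x : Ω | x.1 ∈ cylinder u} * F u := by
  have hmeas : Measurable fun x : Ω => pre k x.1 := (measurable_pre hm k).comp measurable_subtype_coe
  have hprob := Measure.isProbabilityMeasure_map (μ := μ) hmeas.aemeasurable
  have h2 : ∀ u, (μ.map fun x : Ω => pre k x.1).real {u} = μ.real {x : Ω | x.1 ∈ cylinder u} := by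
    intro u
    rw [map_measureReal_apply hmeas (measurableSet_singleton u)]
    congr 1
    ext x
    simp [mem_cylinder]
  rw [← integral_map (φ := fun x : Ω => pre k x.1) hmeas.aemeasurable
    (measurable_of_finite F).aestronglyMeasurable, integral_fintype (Integrable.of_finite),
    ← Finset.sum_subset (Finset.subset_univ (prefixes Ω k))]
  · simp [h2]
  · intro u _ hu
    rw [h2, measureReal_cylinder_eq_zero μ hu, zero_smul]

theorem sum_measureReal_cylinder [IsProbabilityMeasure μ] (hm : 2 ≤ m) (k : ℕ) :
    ∑ u ∈ prefixes Ω k, μ.real {x : Ω | x.1 ∈ cylinder u} = 1 := by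
  simpa using (integral_pre μ hm k fun _ => 1).symm

/-- The entropy of the partition into cylinders, with natural logarithms. -/
def natEntropy (Ω : Set (SymbolicSpace m)) (μ : Measure Ω) (k : ℕ) : ℝ :=
  ∑ u ∈ prefixes Ω k, Real.negMulLog (μ.real {x : Ω | x.1 ∈ cylinder u})

theorem cylinderEntropy_eq (k : ℕ) : cylinderEntropy Ω μ k = natEntropy Ω μ k / Real.log m := by
  rw [cylinderEntropy, natEntropy, Finset.sum_div, ← Finset.sum_neg_distrib]
  refine Finset.sum_congr rfl fun u _ => ?_
  rw [Real.logb, Real.negMulLog]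
  ring

theorem natEntropy_nonneg [IsProbabilityMeasure μ] (k : ℕ) : 0 ≤ natEntropy Ω μ k :=
  Finset.sum_nonneg fun _ _ => Real.negMulLog_nonneg measureReal_nonneg measureReal_le_one

theorem natEntropy_le [IsProbabilityMeasure μ] (hm : 2 ≤ m) (hne : Ω.Nonempty) (k : ℕ) :
    natEntropy Ω μ k ≤ Real.log m * k :=
  (sum_negMulLog_le_log_card (fun _ _ => measureReal_nonneg)
    (sum_measureReal_cylinder μ hm k)).trans (log_card_prefixes_le hne k)

theorem natEntropy_zero [IsProbabilityMeasure μ] (hm : 2 ≤ m) (hne : Ω.Nonempty) : natEntropy Ω μ 0 = 0 := by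
  refine le_antisymm ?_ (natEntropy_nonneg μ 0)
  simpa using natEntropy_le μ hm hne 0

theorem entropyTerm_eq (k : ℕ) : entropyTerm p Ω μ k =
    natEntropy Ω μ (k + 1) * (1 / (ell p k : ℝ) - 1 / (ell p (k + 1) : ℝ)) / Real.log m := by
  rw [entropyTerm, cylinderEntropy_eq]
  ring

theorem summable_natEntropy [IsProbabilityMeasure μ] (hm : 2 ≤ m) (hJ : 0 < J) (hp : ∀ j, (p j).Prime) (hne : Ω.Nonempty) :
    Summable fun k => natEntropy Ω μ (k + 1) *
      (1 / (ell p k : ℝ) - 1 / (ell p (k + 1) : ℝ)) :=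
  summable_mul_one_div_ell_sub hJ hp (natEntropy_nonneg μ) (natEntropy_le μ hm hne)

theorem summable_entropyTerm [IsProbabilityMeasure μ] (hm : 2 ≤ m) (hJ : 0 < J) (hp : ∀ j, (p j).Prime) (hne : Ω.Nonempty) :
    Summable (entropyTerm p Ω μ) := by
  simp only [funext (entropyTerm_eq μ)]
  exact (summable_natEntropy μ hm hJ hp hne).div_const _

theorem entropySum_eq : entropySum p Ω μ =
    (gammaS p)⁻¹ * (∑' k, natEntropy Ω μ (k + 1) *
      (1 / (ell p k : ℝ) - 1 / (ell p (k + 1) : ℝ))) / Real.log m := by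
  rw [entropySum, funext (entropyTerm_eq μ), tsum_div_const, mul_div_assoc]

end Measure

/-- A measure on `Ω` with finite support which realizes the optimal weights up to level `N`. -/
theorem exists_measureReal_cylinder_eq_weight (hm : 2 ≤ m) (hJ : 0 < J) (hp : ∀ j, (p j).Prime)
    (hne : Ω.Nonempty) (N : ℕ) :
    ∃ μ : ProbabilityMeasure Ω, ∀ k ≤ N, ∀ u ∈ prefixes Ω k,
      (μ : Measure Ω).real {x : Ω | x.1 ∈ cylinder u} = weight p Ω k u := by
  classical
  have hex : ∀ u : Fin N → Fin m, ∃ x : Ω, u ∈ prefixes Ω N → pre N x.1 = u := by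
    intro u
    by_cases hu : u ∈ prefixes Ω N
    · obtain ⟨x, hx, h⟩ := mem_prefixes.1 hu
      exact ⟨⟨x, hx⟩, fun _ => h⟩
    · exact ⟨⟨_, hne.some_mem⟩, fun h => absurd h hu⟩
  choose x hx using hex
  set ν : Measure Ω :=
    ∑ u ∈ prefixes Ω N, ENNReal.ofReal (weight p Ω N u) • Measure.dirac (x u) with hν
  have happ : ∀ s, MeasurableSet s →
      ν s = ∑ u ∈ prefixes Ω N, ENNReal.ofReal (weight p Ω N u) * s.indicator 1 (x u) := by
    intro s hs
    rw [hν, Measure.finsetSum_apply]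
    exact Finset.sum_congr rfl fun u _ => by
      rw [Measure.smul_apply, Measure.dirac_apply' _ hs, smul_eq_mul]
  have hprob : IsProbabilityMeasure ν := by
    constructor
    rw [happ _ MeasurableSet.univ]
    simp only [Set.indicator_univ, Pi.one_apply, mul_one]
    rw [← ENNReal.ofReal_sum_of_nonneg fun u _ => (weight_pos N u).le, sum_weight hm hJ hp hne N,
      ENNReal.ofReal_one]
  refine ⟨⟨ν, hprob⟩, ?_⟩
  change ∀ k ≤ N, ∀ u ∈ prefixes Ω k, ν.real {x : Ω | x.1 ∈ cylinder u} = weight p Ω k u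
  intro k hk
  induction hk using Nat.decreasingInduction with
  | self =>
    intro v hv
    rw [Measure.real, happ _ (measurableSet_coe_cylinder hm v), Finset.sum_eq_single v]
    · have hv' : x v ∈ {y : Ω | y.1 ∈ cylinder v} := mem_cylinder.2 (hx v hv)
      rw [Set.indicator_of_mem hv', Pi.one_apply, mul_one,
        ENNReal.toReal_ofReal (weight_pos N v).le]
    · intro u hu huv
      rw [Set.indicator_of_notMem, mul_zero]
      intro h
      exact huv ((hx u hu).symm.trans (mem_cylinder.1 h))
    · exact fun h => absurd hv h
  | of_succ k _ ih =>
    intro u hu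
    rw [← sum_measureReal_snoc ν hm u, ← sum_weight_snoc hm hJ hp hu]
    exact Finset.sum_congr rfl fun a ha => ih _ (mem_continuations_iff.1 ha)

theorem pot_le_iSup_entropySum (hm : 2 ≤ m) (hJ : 0 < J) (hp : ∀ j, (p j).Prime)
    (hne : Ω.Nonempty) :
    ENNReal.ofReal ((gammaS p)⁻¹ * pot p Ω 0 Fin.elim0 / Real.log m) ≤
      ⨆ μ : ProbabilityMeasure Ω, ENNReal.ofReal (entropySum p Ω (μ : Measure Ω)) := by
  have hlm : 0 ≤ Real.log m := Real.log_natCast_nonneg m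
  have hγ := gammaS_pos hJ hp
  have h1 := (summable_weightEntropy hm hJ hp hne).hasSum.tendsto_sum_nat
  rw [tsum_weightEntropy hm hJ hp hne] at h1
  refine le_of_tendsto' (ENNReal.tendsto_ofReal ((h1.const_mul (gammaS p)⁻¹).div_const
    (Real.log m))) fun N => ?_
  obtain ⟨μ, hμ⟩ := exists_measureReal_cylinder_eq_weight (p := p) hm hJ hp hne N
  refine le_iSup_of_le μ (ENNReal.ofReal_le_ofReal ?_)
  rw [entropySum_eq]
  refine div_le_div_of_nonneg_right (mul_le_mul_of_nonneg_left ?_ (by positivity)) hlm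
  refine le_trans (le_of_eq ?_) ((summable_natEntropy (μ : Measure Ω) hm hJ hp hne).sum_le_tsum
    (Finset.range N) fun k _ =>
      mul_nonneg (natEntropy_nonneg _ _) (one_div_ell_sub_pos hJ hp k).le)
  refine Finset.sum_congr rfl fun k hk => ?_
  congr 1
  exact Finset.sum_congr rfl fun u hu => by rw [hμ (k + 1) (Finset.mem_range.1 hk) u hu]

end SymbolicSpace

/-- If the partial sums of `v` are nonnegative, then the sums of `r * v r` cannot be
eventually below `-ε n`. -/
theorem frequently_neg_mul_le_sum_mul {v : ℕ → ℝ}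
    (hv : ∀ n, 0 ≤ ∑ r ∈ Finset.Icc 1 n, v r) {ε : ℝ} (hε : 0 < ε) :
    ∃ᶠ n : ℕ in atTop, -(ε * n) ≤ ∑ r ∈ Finset.Icc 1 n, r * v r := by
  intro hcon
  simp only [not_le] at hcon
  set V : ℕ → ℝ := fun n => ∑ r ∈ Finset.Icc 1 n, v r with hV
  have hA : ∀ n : ℕ, ∑ r ∈ Finset.Icc 1 n, r * v r = n * V n - ∑ i ∈ Finset.range n, V i := by
    intro n
    induction n with
    | zero => simp
    | succ n ih =>
      rw [Finset.sum_Icc_succ_top (by omega), ih, Finset.sum_range_succ]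
      have : V (n + 1) = V n + v (n + 1) := by
        simp only [hV]; rw [Finset.sum_Icc_succ_top (by omega)]
      rw [this]
      push_cast
      ring
  obtain ⟨n₀, hn₀⟩ := eventually_atTop.1 hcon
  set b : ℕ → ℝ := fun n => (∑ i ∈ Finset.range n, V i) / n with hb
  have hb0 : ∀ n, 0 ≤ b n := fun n => div_nonneg (Finset.sum_nonneg fun i _ => hv i) (by positivity)
  set N := max n₀ 1 with hN
  have hstep : ∀ n, N ≤ n → b n + ε * ∑ i ∈ Finset.range n, (1 / (i + 1) : ℝ) ≤
      b N + ε * ∑ i ∈ Finset.range N, (1 / (i + 1) : ℝ) := by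
    intro n hn
    induction n, hn using Nat.le_induction with
    | base => exact le_rfl
    | succ n hn ih =>
      refine le_trans ?_ ih
      have h1 := hn₀ n ((le_max_left _ _).trans hn)
      rw [hA] at h1
      have hn0 : (0 : ℝ) < n := by
        exact_mod_cast lt_of_lt_of_le one_pos ((le_max_right _ _).trans hn)
      rw [Finset.sum_range_succ (fun i : ℕ => (1 / (i + 1) : ℝ)), mul_add, ← add_assoc,
        add_right_comm]
      have : b (n + 1) + ε * (1 / (n + 1)) ≤ b n := by
        simp only [hb, Finset.sum_range_succ]
        push_cast
        rw [mul_one_div, ← add_div, div_le_div_iff₀ (by positivity) hn0]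
        nlinarith
      linarith
  have hdiv := tendsto_atTop.1 (Real.tendsto_sum_range_one_div_nat_succ_atTop.const_mul_atTop hε)
    (b N + ε * ∑ i ∈ Finset.range N, (1 / (i + 1) : ℝ) + 1)
  obtain ⟨n, hn1, hn2⟩ := (hdiv.and (eventually_ge_atTop N)).exists
  linarith [hstep n hn2, hb0 n]

namespace SymbolicSpace

variable {m J : ℕ} {p : Fin J → ℕ} {Ω : Set (SymbolicSpace m)} {k n : ℕ}

theorem ediam_cylinder_le (hm : 2 ≤ m) (u : Fin n → Fin m) :
    Metric.ediam (cylinder u) ≤ ENNReal.ofReal (((m : ℝ)⁻¹) ^ n) := by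
  have hm1 : (1 : ℝ) ≤ m := by exact_mod_cast (by omega : 1 ≤ m)
  refine Metric.ediam_le_of_forall_dist_le fun x hx y hy => ?_
  rw [mem_cylinder] at hx hy
  exact (dist_le_of_pre_eq hm (hx.trans hy.symm)).trans
    (pow_le_pow_of_le_one (by positivity) (inv_le_one_of_one_le₀ hm1) (Nat.le_succ n))

/-- An upper bound for the Hausdorff dimension from weights on cylinders. -/
theorem dimH_le_of_frequently_le_weight (hm : 2 ≤ m) {X : Set (SymbolicSpace m)}
    {q : ∀ n, (Fin n → Fin m) → ℝ} (hq0 : ∀ n u, 0 ≤ q n u)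
    (hq1 : ∀ n, ∑ u ∈ prefixes X n, q n u ≤ 1) {s : ℝ} (hs : 0 ≤ s)
    (h : ∀ x ∈ X, ∀ ε > 0, ∃ᶠ n : ℕ in atTop, Real.exp (-(n * (s + ε))) ≤ q n (pre n x)) :
    dimH X ≤ ENNReal.ofReal (s / Real.log m) := by
  classical
  have hm1 : (1 : ℝ) < m := by exact_mod_cast (by omega : 1 < m)
  have hlm : 0 < Real.log m := Real.log_pos hm1
  refine le_of_forall_gt fun c hc => ?_
  obtain ⟨t, ht, htc⟩ := ENNReal.lt_iff_exists_nnreal_btwn.1 hc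
  refine lt_of_le_of_lt (dimH_le_of_hausdorffMeasure_ne_top ?_) htc
  have hst : s / Real.log m < t := by
    rw [ENNReal.ofReal_lt_iff_lt_toReal (by positivity) ENNReal.coe_ne_top] at ht
    simpa using ht
  have ht0 : (0 : ℝ) < t := lt_of_le_of_lt (by positivity) hst
  rw [div_lt_iff₀ hlm] at hst
  set ε := (t * Real.log m - s) / 2 with hε
  have hε0 : 0 < ε := by rw [hε]; linarith
  set A : ℕ → (Σ n, (Fin n → Fin m)) → Set (SymbolicSpace m) := fun N w =>
    if N ≤ w.1 ∧ w.2 ∈ prefixes X w.1 ∧ Real.exp (-(w.1 * (s + ε))) ≤ q w.1 w.2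
      then cylinder w.2 else ∅ with hA
  have hr0 : Tendsto (fun N : ℕ => ENNReal.ofReal (((m : ℝ)⁻¹) ^ N)) atTop (𝓝 0) := by
    rw [← ENNReal.ofReal_zero]
    exact ENNReal.tendsto_ofReal
      (tendsto_pow_atTop_nhds_zero_of_lt_one (by positivity) (inv_lt_one_of_one_lt₀ hm1))
  have hle := Measure.hausdorffMeasure_le_liminf_tsum (t : ℝ) X (l := atTop)
    (fun N : ℕ => ENNReal.ofReal (((m : ℝ)⁻¹) ^ N)) hr0 A
    (Eventually.of_forall fun N w => ?_) (Eventually.of_forall fun N x hx => ?_)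
  rotate_left
  · simp only [hA]
    split_ifs with hw
    · refine (ediam_cylinder_le hm _).trans (ENNReal.ofReal_le_ofReal ?_)
      exact pow_le_pow_of_le_one (by positivity) (inv_lt_one_of_one_lt₀ hm1).le hw.1
    · simp
  · obtain ⟨n, hn, hn2⟩ := ((h x hx ε hε0).and_eventually (eventually_ge_atTop N)).exists
    refine Set.mem_iUnion.2 ⟨⟨n, pre n x⟩, ?_⟩
    simp only [hA]
    rw [if_pos ⟨hn2, pre_mem_prefixes hx n, hn⟩]
    exact mem_cylinder.2 rfl
  have hsum : Summable fun n : ℕ => Real.exp (-ε) ^ n :=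
    summable_geometric_of_lt_one (Real.exp_pos _).le (Real.exp_lt_one_iff.2 (by linarith))
  refine ne_top_of_le_ne_top (b := ENNReal.ofReal (∑' n : ℕ, Real.exp (-ε) ^ n))
    ENNReal.ofReal_ne_top (hle.trans ?_)
  refine (liminf_le_liminf (v := fun _ => ENNReal.ofReal (∑' n : ℕ, Real.exp (-ε) ^ n))
    (Eventually.of_forall fun N => ?_)).trans_eq (liminf_const _)
  rw [ENNReal.ofReal_tsum_of_nonneg (fun n => by positivity) hsum, ENNReal.tsum_sigma']
  refine ENNReal.tsum_le_tsum fun n => ?_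
  rw [tsum_fintype]
  have hterm : ∀ u : Fin n → Fin m, Metric.ediam (A N ⟨n, u⟩) ^ (t : ℝ) ≤
      if u ∈ prefixes X n then ENNReal.ofReal (q n u * Real.exp (-ε) ^ n) else 0 := by
    intro u
    simp only [hA]
    by_cases hw : N ≤ n ∧ u ∈ prefixes X n ∧ Real.exp (-(n * (s + ε))) ≤ q n u
    · rw [if_pos hw, if_pos hw.2.1]
      refine (ENNReal.rpow_le_rpow (ediam_cylinder_le hm u) ht0.le).trans ?_
      rw [ENNReal.ofReal_rpow_of_nonneg (by positivity) ht0.le]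
      refine ENNReal.ofReal_le_ofReal ?_
      refine le_trans (le_of_eq ?_) (mul_le_mul_of_nonneg_right hw.2.2 (by positivity))
      rw [← Real.exp_nat_mul, ← Real.exp_add, ← Real.rpow_natCast, ← Real.rpow_mul (by positivity),
        Real.rpow_def_of_pos (by positivity), Real.log_inv]
      congr 1
      rw [hε]
      ring
    · rw [if_neg hw]
      simp [ht0]
  refine (Finset.sum_le_sum fun u _ => hterm u).trans ?_
  rw [← Finset.sum_filter, Finset.filter_mem_eq_inter, Finset.univ_inter,
    ← ENNReal.ofReal_sum_of_nonneg fun u _ => mul_nonneg (hq0 n u) (by positivity),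
    ← Finset.sum_mul]
  exact ENNReal.ofReal_le_ofReal (mul_le_of_le_one_left (by positivity) (hq1 n))

/-- The logarithm of the conditional probability of the digit at position `r`. -/
def logStep (p : Fin J → ℕ) (Ω : Set (SymbolicSpace m)) (r : ℕ) (x : SymbolicSpace m) : ℝ :=
  ell p (idx p r) * (pot p Ω (idx p r + 1) (pre (idx p r + 1) (restrict p (core p r) x)) -
    pot p Ω (idx p r) (pre (idx p r) (restrict p (core p r) x)))

theorem pre_restrict_congr (hJ : 0 < J) (hp : ∀ j, (p j).Prime) {x y : SymbolicSpace m}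
    (h : pre n x = pre n y) {i : ℕ} (hi : 0 < i) (hk : ∀ j < k, i * ell p j ≤ n) :
    pre k (restrict p i x) = pre k (restrict p i y) := by
  refine pre_eq_iff.2 fun j hj => ?_
  have h1 := hk j hj
  have h2 := Nat.mul_pos hi (ell_pos hJ hp j)
  exact pre_eq_iff.1 h (i * ell p j - 1) (by omega)

theorem logStep_congr (hJ : 0 < J) (hp : ∀ j, (p j).Prime) {x y : SymbolicSpace m}
    (h : pre n x = pre n y) {r : ℕ} (hr : r ∈ Finset.Icc 1 n) :
    logStep p Ω r x = logStep p Ω r y := by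
  obtain ⟨hr1, hrn⟩ := Finset.mem_Icc.1 hr
  have hi := (isCore_core hp hr1).pos hJ
  have hle : ∀ j < idx p r + 1, core p r * ell p j ≤ n := fun j hj =>
    (Nat.mul_le_mul_left _ ((ell_strictMono hJ hp).monotone (Nat.lt_succ_iff.1 hj))).trans
      ((core_mul_ell hp hr1).le.trans hrn)
  rw [logStep, logStep, pre_restrict_congr hJ hp h hi hle,
    pre_restrict_congr hJ hp h hi fun j hj => hle j (hj.trans (Nat.lt_succ_self _))]

/-- The sequence which continues the word `u` by the digits of `x₀`. -/
def pad (x₀ : SymbolicSpace m) (u : Fin n → Fin m) : SymbolicSpace m :=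
  ⟨fun i => if h : i < n then u ⟨i, h⟩ else x₀ i⟩

theorem pre_pad (x₀ : SymbolicSpace m) (u : Fin n → Fin m) : pre n (pad x₀ u) = u := by
  funext i
  simp [pre, pad]

theorem sum_exp_logStep_le_one (hm : 2 ≤ m) (hJ : 0 < J) (hp : ∀ j, (p j).Prime)
    (x₀ : SymbolicSpace m) (n : ℕ) :
    ∑ u ∈ prefixes (fractal p Ω) n,
      Real.exp (∑ r ∈ Finset.Icc 1 n, logStep p Ω r (pad x₀ u)) ≤ 1 := by
  induction n with
  | zero => simpa using Finset.card_le_one_of_subsingleton _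
  | succ n ih =>
    rw [sum_prefixes_succ]
    refine (Finset.sum_le_sum fun u hu => ?_).trans ih
    obtain ⟨y, hy, rfl⟩ := mem_prefixes.1 hu
    have hr0 : 0 < n + 1 := Nat.succ_pos n
    set i := core p (n + 1) with hi
    set k := idx p (n + 1) with hk
    have hik : i * ell p k = n + 1 := core_mul_ell hp hr0
    have hic : IsCore p i := isCore_core hp hr0
    set w := pre k (restrict p i y) with hw
    have hwmem : w ∈ prefixes Ω k := pre_mem_prefixes ((mem_fractal_iff hJ).1 hy i hic) k
    have hlt : ∀ j < k, i * ell p j ≤ n := by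
      intro j hj
      have := Nat.mul_lt_mul_of_pos_left (ell_strictMono hJ hp hj) (hic.pos hJ)
      omega
    have hterm : ∀ a ∈ continuations (fractal p Ω) (pre n y),
        Real.exp (∑ r ∈ Finset.Icc 1 (n + 1), logStep p Ω r
          (pad x₀ (Fin.snoc (pre n y) a : Fin (n + 1) → Fin m))) =
        Real.exp (∑ r ∈ Finset.Icc 1 n, logStep p Ω r (pad x₀ (pre n y))) *
          (Real.exp (ell p k * pot p Ω (k + 1) (Fin.snoc w a)) / Real.exp (ell p k * pot p Ω k w)) ∧
        a ∈ continuations Ω w := by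
      intro a ha
      obtain ⟨z, hz, hzy, rfl⟩ := mem_continuations.1 ha
      have hzw : pre k (restrict p i z) = w := pre_restrict_congr hJ hp hzy (hic.pos hJ) hlt
      have hzd : restrict p i z k = z n := by
        simp only [restrict, hik, Nat.add_sub_cancel]
      constructor
      · rw [← hzy, snoc_pre, Finset.sum_Icc_succ_top (by omega), Real.exp_add, ← Real.exp_sub]
        congr 2
        · refine Finset.sum_congr rfl fun r hr => logStep_congr hJ hp (n := n) ?_ hr
          rw [pre_pad]
          exact pre_eq_of_le (Nat.le_succ n) (pre_pad x₀ _)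
        · rw [logStep_congr hJ hp (n := n + 1) (y := z) (pre_pad x₀ _)
            (Finset.mem_Icc.2 ⟨hr0, le_rfl⟩), logStep, ← hi, ← hk, ← snoc_pre, hzw, hzd, mul_sub]
      · rw [← hzw, ← hzd]
        exact digit_mem_continuations ((mem_fractal_iff hJ).1 hz i hic) k
    rw [Finset.sum_congr rfl fun a ha => (hterm a ha).1, ← Finset.mul_sum, ← Finset.sum_div]
    refine mul_le_of_le_one_right (Real.exp_pos _).le ?_
    rw [div_le_one (Real.exp_pos _), ← exp_mul_pot hm hJ hp hwmem]
    exact Finset.sum_le_sum_of_subset_of_nonneg (fun a ha => (hterm a ha).2)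
      fun a _ _ => (Real.exp_pos _).le

theorem frequently_le_sum_logStep (hm : 2 ≤ m) (hJ : 0 < J) (hp : ∀ j, (p j).Prime)
    (x : SymbolicSpace m) {ε : ℝ} (hε : 0 < ε) :
    ∃ᶠ n : ℕ in atTop, -(n * ((gammaS p)⁻¹ * pot p Ω 0 Fin.elim0 + ε)) ≤
      ∑ r ∈ Finset.Icc 1 n, logStep p Ω r x := by
  set T : ℕ → ℕ → ℝ := fun i k =>
    if k = 0 then 0 else pot p Ω k (pre k (restrict p i x)) / i with hT
  set P := pot p Ω 0 Fin.elim0 with hP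
  have hP0 : 0 ≤ P := pot_nonneg hm hJ hp 0 _
  have hV : ∀ n, 0 ≤ ∑ r ∈ Finset.Icc 1 n,
      (T (core p r) (idx p r + 1) - T (core p r) (idx p r)) := by
    intro n
    rw [sum_Icc_eq_sum_chains hJ hp n fun i k => T i (k + 1) - T i k]
    refine Finset.sum_nonneg fun i _ => ?_
    rw [Finset.sum_range_sub]
    simp only [hT, if_true, sub_zero]
    split_ifs
    · exact le_rfl
    · exact div_nonneg (pot_nonneg hm hJ hp _ _) (by positivity)
  have hdecomp : ∀ n : ℕ, ∑ r ∈ Finset.Icc 1 n, logStep p Ω r x =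
      ∑ r ∈ Finset.Icc 1 n, r * (T (core p r) (idx p r + 1) - T (core p r) (idx p r)) -
        P * ∑ r ∈ Finset.Icc 1 n, (if idx p r = 0 then (1 : ℝ) else 0) := by
    intro n
    rw [Finset.mul_sum, ← Finset.sum_sub_distrib]
    refine Finset.sum_congr rfl fun r hr => ?_
    have hr1 := (Finset.mem_Icc.1 hr).1
    have hi : (core p r : ℝ) ≠ 0 := by
      exact_mod_cast ((isCore_core hp hr1).pos hJ).ne'
    have hr' : (r : ℝ) = core p r * ell p (idx p r) := by exact_mod_cast (core_mul_ell hp hr1).symm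
    rw [logStep]
    generalize idx p r = k at hr' ⊢
    by_cases h0 : k = 0
    · subst h0
      have hl : ell p 0 = 1 := ell_zero hJ hp
      have hP' : ∀ w, pot p Ω 0 w = P := fun w => by rw [hP, Subsingleton.elim w Fin.elim0]
      simp only [hT, hr', hP', hl]
      simp
      field_simp
    · simp only [hT, h0, hr', if_false, Nat.add_eq_zero_iff, one_ne_zero, and_false, mul_zero,
        sub_zero]
      field_simp
  have hcount := (tendsto_sum_idx_div_gammaS hJ hp (h := fun k => if k = 0 then (1 : ℝ) else 0)
    (C := 1) (fun k => by split_ifs <;> simp)).const_mul P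
  have hlim : (gammaS p)⁻¹ * ∑' k, (if k = 0 then (1 : ℝ) else 0) / ell p k = (gammaS p)⁻¹ := by
    rw [tsum_eq_single 0]
    · simp [ell_zero hJ hp]
    · intro k hk
      simp [hk]
  rw [hlim] at hcount
  have hev := hcount.eventually_lt_const (show P * (gammaS p)⁻¹ < P * (gammaS p)⁻¹ + ε / 2 by
    linarith)
  refine ((frequently_neg_mul_le_sum_mul hV (half_pos hε)).and_eventually
    (hev.and (eventually_gt_atTop 0))).mono ?_
  rintro n ⟨h1, h2, hn⟩
  have hn' : (0 : ℝ) < n := by exact_mod_cast hn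
  rw [← mul_div_assoc, div_lt_iff₀ hn'] at h2
  rw [hdecomp]
  nlinarith

theorem dimH_fractal_le (hm : 2 ≤ m) (hJ : 0 < J) (hp : ∀ j, (p j).Prime) (hne : Ω.Nonempty) :
    dimH (fractal p Ω) ≤ ENNReal.ofReal ((gammaS p)⁻¹ * pot p Ω 0 Fin.elim0 / Real.log m) := by
  obtain ⟨x₀, _⟩ := hne
  refine dimH_le_of_frequently_le_weight hm
    (q := fun n u => Real.exp (∑ r ∈ Finset.Icc 1 n, logStep p Ω r (pad x₀ u)))
    (fun n u => (Real.exp_pos _).le) (sum_exp_logStep_le_one hm hJ hp x₀)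
    (mul_nonneg (inv_nonneg.2 (gammaS_pos hJ hp).le) (pot_nonneg hm hJ hp 0 _))
    fun x _ ε hε => ?_
  refine (frequently_le_sum_logStep (Ω := Ω) hm hJ hp x hε).mono fun n hn => Real.exp_le_exp.2 ?_
  rwa [Finset.sum_congr rfl fun r hr => logStep_congr hJ hp (n := n) (y := x) (pre_pad x₀ _) hr]

end SymbolicSpace

section Cores

variable {J : ℕ} {p : Fin J → ℕ}

theorem isCore_infinite (hp : ∀ j, (p j).Prime) : (Set.ofPred (IsCore p)).Infinite := by
  have hQ : 0 < ∏ j, p j := Finset.prod_pos fun j _ => (hp j).pos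
  refine Set.infinite_of_injective_forall_mem (f := fun n : ℕ => n * ∏ j, p j + 1) ?_ fun n j h => ?_
  · intro a b h
    exact Nat.eq_of_mul_eq_mul_right hQ (Nat.add_right_cancel h)
  · have h1 : p j ∣ n * ∏ j, p j :=
      Dvd.dvd.mul_left (Finset.dvd_prod_of_mem p (Finset.mem_univ j)) n
    exact (hp j).ne_one (Nat.dvd_one.1 ((Nat.dvd_add_right h1).1 h))

theorem sum_coresUpTo (n : ℕ) (f : ℕ → ℝ) :
    ∑ i ∈ coresUpTo p n, f i = ∑ a ∈ Finset.range (coreCount p n), f (Nat.nth (IsCore p) a) := by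
  classical
  rw [coresUpTo, coreCount]
  induction n + 1 with
  | zero => simp
  | succ N ih =>
    rw [Finset.range_add_one, Finset.filter_insert, Nat.count_succ]
    split_ifs with h
    · rw [Finset.sum_insert (by simp), Finset.sum_range_succ, ih, Nat.nth_count h, add_comm]
    · rw [ih, add_zero]

theorem tendsto_coreCount_atTop (hJ : 0 < J) (hp : ∀ j, (p j).Prime) :
    Tendsto (coreCount p) atTop atTop := by
  obtain ⟨B, hB⟩ := abs_coreCount_sub_le hJ hp
  rw [← tendsto_natCast_atTop_iff (R := ℝ)]
  have h1 : Tendsto (fun n : ℕ => (gammaS p)⁻¹ * n + -B) atTop atTop :=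
    tendsto_atTop_add_const_right _ _
      (tendsto_natCast_atTop_atTop.const_mul_atTop (inv_pos.2 (gammaS_pos hJ hp)))
  refine tendsto_atTop_mono (fun n => ?_) h1
  have := (abs_le.1 (hB n)).1
  linarith

theorem tendsto_coreCount_div_ell_gammaS (hJ : 0 < J) (hp : ∀ j, (p j).Prime) (k : ℕ) :
    Tendsto (fun n : ℕ => (coreCount p (n / ell p k) : ℝ) / n) atTop
      (𝓝 ((gammaS p)⁻¹ / ell p k)) := by
  obtain ⟨B, hB⟩ := abs_coreCount_sub_le hJ hp
  exact tendsto_coreCount_div_ell hJ hp hB k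

/-- Averages along the cores transfer to averages along the multiples of `ell p k`. -/
theorem tendsto_sum_coresUpTo_div (hJ : 0 < J) (hp : ∀ j, (p j).Prime) {f : ℕ → ℝ} {c : ℝ}
    (hf : Tendsto (fun N : ℕ => (∑ a ∈ Finset.range N, f (Nat.nth (IsCore p) a)) / N) atTop (𝓝 c))
    (k : ℕ) :
    Tendsto (fun n : ℕ => (∑ i ∈ coresUpTo p (n / ell p k), f i) / n) atTop
      (𝓝 (c * ((gammaS p)⁻¹ / ell p k))) := by
  have h1 := hf.comp ((tendsto_coreCount_atTop hJ hp).comp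
    (Nat.tendsto_div_const_atTop (n := ell p k) (ell_pos hJ hp k).ne'))
  refine (h1.mul (tendsto_coreCount_div_ell_gammaS hJ hp k)).congr fun n => ?_
  simp only [Function.comp_apply]
  rw [sum_coresUpTo]
  rcases Nat.eq_zero_or_pos (coreCount p (n / ell p k)) with h | h
  · simp [h]
  · have : (coreCount p (n / ell p k) : ℝ) ≠ 0 := by exact_mod_cast h.ne'
    exact div_mul_div_cancel₀ this

end Cores

namespace SymbolicSpace

variable {m J : ℕ} {p : Fin J → ℕ} {Ω : Set (SymbolicSpace m)} {k n : ℕ}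

/-- The mass distribution principle for cylinders. -/
theorem le_dimH_of_measureReal_cylinder_le (hm : 2 ≤ m) {X : Set (SymbolicSpace m)}
    (P : Measure (SymbolicSpace m)) [IsFiniteMeasure P] {s : ℝ} (hs : 0 < s) {n₀ : ℕ}
    (h : P (X ∩ {x | ∀ n ≥ n₀, P.real (cylinder (pre n x)) ≤ Real.exp (-(n * s))}) ≠ 0) :
    ENNReal.ofReal (s / Real.log m) ≤ dimH X := by
  have hm1 : (1 : ℝ) < m := by exact_mod_cast (by omega : 1 < m)
  have hlm : 0 < Real.log m := Real.log_pos hm1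
  set E := {x | ∀ n ≥ n₀, P.real (cylinder (pre n x)) ≤ Real.exp (-(n * s))} with hE
  have hEmeas : MeasurableSet E := by
    have : E = ⋂ (n : ℕ) (_ : n ≥ n₀),
        pre n ⁻¹' {u : Fin n → Fin m | P.real (cylinder u) ≤ Real.exp (-(n * s))} := by
      ext x; simp [hE]
    rw [this]
    exact MeasurableSet.iInter fun n => MeasurableSet.iInter fun _ =>
      measurable_pre hm n (Set.toFinite _).measurableSet
  set t : ℝ≥0 := ⟨s / Real.log m, by positivity⟩ with ht
  have ht0 : (0 : ℝ) < t := div_pos hs hlm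
  have hts : (t : ℝ) * Real.log m = s := div_mul_cancel₀ _ hlm.ne'
  set C : ℝ≥0∞ := ENNReal.ofReal (Real.exp (2 * s)) with hC
  have hC0 : C ≠ 0 := by rw [hC]; simp [Real.exp_pos]
  have hC1 : C ≠ ⊤ := ENNReal.ofReal_ne_top
  set y : ℝ := (m : ℝ)⁻¹ with hy
  have hy0 : 0 < y := by positivity
  have hy1 : y < 1 := inv_lt_one_of_one_lt₀ hm1
  have hypow : ∀ n : ℕ, (ENNReal.ofReal (y ^ n)) ^ (t : ℝ) = ENNReal.ofReal (Real.exp (-(n * s))) := by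
    intro n
    rw [ENNReal.ofReal_rpow_of_nonneg (by positivity) ht0.le, ← Real.rpow_natCast,
      ← Real.rpow_mul hy0.le, Real.rpow_def_of_pos hy0, hy, Real.log_inv, ← hts]
    congr 2
    ring
  have hcyl : ∀ (A : Set (SymbolicSpace m)) (n : ℕ), n₀ ≤ n →
      Metric.ediam A ≤ ENNReal.ofReal (y ^ (n + 1)) →
      P (A ∩ E) ≤ ENNReal.ofReal (Real.exp (-(n * s))) := by
    intro A n hn hA
    rcases (A ∩ E).eq_empty_or_nonempty with h0 | ⟨x, hxA, hxE⟩
    · simp [h0]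
    · have hsub : A ∩ E ⊆ cylinder (pre n x) := by
        rintro z ⟨hzA, _⟩
        rw [mem_cylinder]
        refine pre_eq_of_dist_lt hm (lt_of_le_of_lt ?_ (pow_lt_pow_right_of_lt_one₀ hy0 hy1
          (Nat.lt_succ_self n)))
        have h1 := (Metric.edist_le_ediam_of_mem hzA hxA).trans hA
        rwa [edist_dist, ENNReal.ofReal_le_ofReal_iff (by positivity)] at h1
      refine (measure_mono hsub).trans ?_
      rw [ENNReal.le_ofReal_iff_toReal_le (measure_ne_top _ _) (Real.exp_pos _).le]
      exact hxE n hn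
  have hle : C⁻¹ • P.restrict E ≤ Measure.hausdorffMeasure (t : ℝ) := by
    refine Measure.le_hausdorffMeasure _ _ (ENNReal.ofReal (y ^ (n₀ + 2)))
      (ENNReal.ofReal_pos.2 (by positivity)) fun A hA => ?_
    rw [Measure.smul_apply, smul_eq_mul, Measure.restrict_apply' hEmeas,
      ENNReal.inv_mul_le_iff hC0 hC1]
    have hAtop : Metric.ediam A ≠ ⊤ := ne_top_of_le_ne_top ENNReal.ofReal_ne_top hA
    rcases eq_or_ne (Metric.ediam A) 0 with h0 | h0
    · have hlim : Tendsto (fun n : ℕ => ENNReal.ofReal (Real.exp (-(n * s)))) atTop (𝓝 0) := by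
        rw [← ENNReal.ofReal_zero]
        refine ENNReal.tendsto_ofReal (Real.tendsto_exp_neg_atTop_nhds_zero.comp ?_)
        exact tendsto_natCast_atTop_atTop.atTop_mul_const hs
      have : P (A ∩ E) ≤ 0 := by
        refine ge_of_tendsto hlim ?_
        filter_upwards [eventually_ge_atTop n₀] with n hn
        exact hcyl A n hn (by rw [h0]; exact zero_le)
      exact this.trans zero_le
    · have hd0 : 0 < (Metric.ediam A).toReal := ENNReal.toReal_pos h0 hAtop
      have hd1 : (Metric.ediam A).toReal ≤ y ^ (n₀ + 2) :=
        ENNReal.toReal_le_of_le_ofReal (by positivity) hA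
      obtain ⟨n, hn1, hn2⟩ := exists_nat_pow_near_of_lt_one hd0
        (hd1.trans (pow_le_one₀ hy0.le hy1.le)) hy0 hy1
      have hn3 : n₀ + 2 < n + 1 :=
        (pow_lt_pow_iff_right_of_lt_one₀ hy0 hy1).1 (hn1.trans_le hd1)
      obtain ⟨j, rfl⟩ : ∃ j, n = j + 1 := ⟨n - 1, by omega⟩
      refine (hcyl A j (by omega) ?_).trans ?_
      · rw [ENNReal.le_ofReal_iff_toReal_le hAtop (by positivity)]
        exact hn2
      · have h2 : ENNReal.ofReal (y ^ (j + 1 + 1)) ≤ Metric.ediam A :=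
          (ENNReal.ofReal_le_iff_le_toReal hAtop).2 hn1.le
        refine le_trans ?_ (mul_le_mul_right (ENNReal.rpow_le_rpow h2 ht0.le) C)
        rw [hypow, hC, ← ENNReal.ofReal_mul (Real.exp_pos _).le, ← Real.exp_add]
        refine ENNReal.ofReal_le_ofReal (Real.exp_le_exp.2 (le_of_eq ?_))
        push_cast
        ring
  have hne : Measure.hausdorffMeasure (t : ℝ) X ≠ 0 := by
    intro h0
    have h1 := hle X
    rw [h0, Measure.smul_apply, smul_eq_mul, Measure.restrict_apply' hEmeas, nonpos_iff_eq_zero,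
      mul_eq_zero] at h1
    rcases h1 with h1 | h1
    · exact hC1 (ENNReal.inv_eq_zero.1 h1)
    · exact h h1
  have h2 := le_dimH_of_hausdorffMeasure_ne_zero hne
  rwa [ENNReal.ofReal, Real.toNNReal_of_nonneg (show 0 ≤ s / Real.log m by positivity)]

section Information

variable (μ : Measure Ω)

/-- The conditional probability of the digit at position `k` given the previous ones. -/
def condProb (k : ℕ) (v : Fin (k + 1) → Fin m) : ℝ :=
  μ.real {x : Ω | x.1 ∈ cylinder v} / μ.real {x : Ω | x.1 ∈ cylinder (Fin.init v : Fin k → Fin m)}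

theorem measureReal_cylinder_le_init [IsProbabilityMeasure μ] (v : Fin (k + 1) → Fin m) :
    μ.real {x : Ω | x.1 ∈ cylinder v} ≤
      μ.real {x : Ω | x.1 ∈ cylinder (Fin.init v : Fin k → Fin m)} := by
  refine measureReal_mono fun x hx => ?_
  simp only [Set.mem_ofPred_eq, mem_cylinder] at hx ⊢
  rw [← hx, init_pre]

theorem condProb_nonneg (v : Fin (k + 1) → Fin m) : 0 ≤ condProb μ k v :=
  div_nonneg measureReal_nonneg measureReal_nonneg

theorem condProb_le_one [IsProbabilityMeasure μ] (v : Fin (k + 1) → Fin m) : condProb μ k v ≤ 1 :=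
  div_le_one_of_le₀ (measureReal_cylinder_le_init μ v) measureReal_nonneg

theorem prod_condProb [IsProbabilityMeasure μ] (x : Ω) (K : ℕ) :
    ∏ k ∈ Finset.range K, condProb μ k (pre (k + 1) x.1) =
      μ.real {y : Ω | y.1 ∈ cylinder (pre K x.1)} := by
  induction K with
  | zero =>
    have : {y : Ω | y.1 ∈ cylinder (pre 0 x.1)} = Set.univ :=
      Set.eq_univ_of_forall fun y => mem_cylinder.2 (Subsingleton.elim _ _)
    rw [this]
    simp
  | succ K ih =>
    rw [Finset.prod_range_succ, ih, condProb, init_pre]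
    refine mul_div_cancel_of_imp' fun h => le_antisymm ?_ measureReal_nonneg
    exact (measureReal_cylinder_le_init μ (pre (K + 1) x.1)).trans h.le

/-- The information of the digit at position `k` given the previous ones. -/
def info (k : ℕ) (x : Ω) : ℝ := -Real.log (condProb μ k (pre (k + 1) x.1))

theorem info_nonneg [IsProbabilityMeasure μ] (x : Ω) : 0 ≤ info μ k x :=
  neg_nonneg.2 (Real.log_nonpos (condProb_nonneg μ _) (condProb_le_one μ _))

theorem condProb_le_exp_neg_info (x : Ω) :
    condProb μ k (pre (k + 1) x.1) ≤ Real.exp (-info μ k x) := by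
  rw [info, neg_neg]
  rcases (condProb_nonneg μ (pre (k + 1) x.1)).eq_or_lt with h | h
  · rw [← h]; exact (Real.exp_pos _).le
  · rw [Real.exp_log h]

theorem integral_info [IsProbabilityMeasure μ] (hm : 2 ≤ m) (k : ℕ) :
    ∫ x, info μ k x ∂μ = natEntropy Ω μ (k + 1) - natEntropy Ω μ k := by
  simp only [info]
  rw [integral_pre μ hm (k + 1) fun v => -Real.log (condProb μ k v)]
  have h1 : ∀ v : Fin (k + 1) → Fin m,
      μ.real {x : Ω | x.1 ∈ cylinder v} * -Real.log (condProb μ k v) =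
        Real.negMulLog (μ.real {x : Ω | x.1 ∈ cylinder v}) +
        μ.real {x : Ω | x.1 ∈ cylinder v} *
          Real.log (μ.real {x : Ω | x.1 ∈ cylinder (Fin.init v : Fin k → Fin m)}) := by
    intro v
    rcases measureReal_nonneg (μ := μ) (s := {x : Ω | x.1 ∈ cylinder v}) |>.eq_or_lt with h | h
    · rw [← h]; simp
    · rw [condProb, Real.log_div h.ne' (h.trans_le (measureReal_cylinder_le_init μ v)).ne',
        Real.negMulLog]
      ring
  rw [Finset.sum_congr rfl fun v _ => h1 v, Finset.sum_add_distrib, natEntropy, natEntropy,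
    sub_eq_add_neg, ← Finset.sum_neg_distrib (s := prefixes Ω k)]
  congr 1
  rw [sum_prefixes_succ]
  refine Finset.sum_congr rfl fun u _ => ?_
  simp only [Fin.init_snoc]
  rw [← Finset.sum_mul, sum_measureReal_snoc μ hm, Real.negMulLog]
  ring

theorem measurable_info (hm : 2 ≤ m) (k : ℕ) : Measurable (info μ k) :=
  (measurable_of_finite fun v => -Real.log (condProb μ k v)).comp
    ((measurable_pre hm (k + 1)).comp measurable_subtype_coe)

theorem integrable_info [IsProbabilityMeasure μ] (hm : 2 ≤ m) (k : ℕ) :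
    Integrable (info μ k) μ := by
  refine Integrable.of_bound (measurable_info μ hm k).aestronglyMeasurable
    (∑ v, ‖-Real.log (condProb μ k v)‖) (Eventually.of_forall fun x => ?_)
  exact Finset.single_le_sum (f := fun v => ‖-Real.log (condProb μ k v)‖)
    (fun v _ => norm_nonneg _) (Finset.mem_univ (pre (k + 1) x.1))

theorem ae_tendsto_sum_info [IsProbabilityMeasure μ] (hm : 2 ≤ m) (hp : ∀ j, (p j).Prime) (k : ℕ) :
    ∀ᵐ ω ∂Measure.infinitePi (fun _ : ℕ => μ),
      Tendsto (fun N : ℕ => (∑ a ∈ Finset.range N, info μ k (ω (Nat.nth (IsCore p) a))) / N) atTop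
        (𝓝 (natEntropy Ω μ (k + 1) - natEntropy Ω μ k)) := by
  have hmeas := measurable_info μ hm k
  have hmp : ∀ i, MeasurePreserving (fun ω : ℕ → Ω => ω i) (Measure.infinitePi fun _ : ℕ => μ) μ :=
    fun i => measurePreserving_eval_infinitePi (fun _ : ℕ => μ) i
  have hmap : ∀ i, (Measure.infinitePi fun _ : ℕ => μ).map (fun ω => info μ k (ω i)) =
      μ.map (info μ k) := by
    intro i
    have h := Measure.map_map (μ := Measure.infinitePi fun _ : ℕ => μ) hmeas (hmp i).measurable
    rw [(hmp i).map_eq] at h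
    exact h.symm
  have h := ProbabilityTheory.strong_law_ae_real
    (μ := Measure.infinitePi fun _ : ℕ => μ)
    (fun a ω => info μ k (ω (Nat.nth (IsCore p) a)))
    ((hmp _).integrable_comp_of_integrable (integrable_info μ hm k)) ?_ ?_
  · rw [← integral_info μ hm k]
    have he : ∫ ω, info μ k (ω (Nat.nth (IsCore p) 0)) ∂(Measure.infinitePi fun _ : ℕ => μ) =
        ∫ x, info μ k x ∂μ := by
      have h' := integral_map (μ := Measure.infinitePi fun _ : ℕ => μ) (f := info μ k)
        (hmp (Nat.nth (IsCore p) 0)).measurable.aemeasurable hmeas.aestronglyMeasurable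
      rw [(hmp _).map_eq] at h'
      exact h'.symm
    rw [he] at h
    exact h
  · intro a b hab
    have hind := (ProbabilityTheory.iIndepFun_infinitePi (P := fun _ : ℕ => μ)
      (X := fun _ => info μ k) fun _ => hmeas).precomp (Nat.nth_injective (isCore_infinite hp))
    exact hind.indepFun hab
  · intro a
    exact ⟨(hmeas.comp (hmp _).measurable).aemeasurable, (hmeas.comp (hmp _).measurable).aemeasurable,
      by rw [hmap, hmap]⟩

/-- Sequences which are independent along the chains. -/
def glueΩ (p : Fin J → ℕ) (ω : ℕ → Ω) : SymbolicSpace m := glue p fun i => (ω i).1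

theorem measurable_glueΩ (hm : 2 ≤ m) : Measurable (glueΩ p : (ℕ → Ω) → SymbolicSpace m) :=
  measurable_of_digits hm fun q => (measurable_digit hm (idx p (q + 1))).comp
    (measurable_subtype_coe.comp (measurable_pi_apply (core p (q + 1))))

/-- The product measure on the fractal. -/
def fractalMeasure (p : Fin J → ℕ) (μ : Measure Ω) : Measure (SymbolicSpace m) :=
  (Measure.infinitePi fun _ : ℕ => μ).map (glueΩ p)

theorem fractalMeasure_real_cylinder [IsProbabilityMeasure μ] (hm : 2 ≤ m) (hJ : 0 < J)
    (hp : ∀ j, (p j).Prime) (ω : ℕ → Ω) (n : ℕ) :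
    (fractalMeasure p μ).real (cylinder (pre n (glueΩ p ω))) =
      ∏ r ∈ Finset.Icc 1 n, condProb μ (idx p r) (pre (idx p r + 1) (ω (core p r)).1) := by
  rw [prod_Icc_eq_prod_chains hJ hp n fun i k => condProb μ k (pre (k + 1) (ω i).1)]
  have hset : glueΩ p ⁻¹' (cylinder (pre n (glueΩ p ω))) =
      Set.pi (coresUpTo p n : Set ℕ)
        fun i => {y : Ω | y.1 ∈ cylinder (pre (chainLen p n i) (ω i).1)} := by
    ext ω'
    rw [Set.mem_preimage, mem_cylinder, pre_eq_iff_restrict hJ hp]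
    simp only [Set.mem_pi, Set.mem_ofPred_eq, mem_cylinder, Finset.mem_coe]
    refine forall₂_congr fun i hi => ?_
    have hc := (mem_coresUpTo.1 hi).2
    rw [glueΩ, glueΩ, restrict_glue hJ hp _ hc, restrict_glue hJ hp _ hc]
  rw [Measure.real, fractalMeasure, Measure.map_apply (measurable_glueΩ hm)
    (measurableSet_cylinder hm _), hset,
    Measure.infinitePi_pi _ fun i _ => measurableSet_coe_cylinder hm _, ENNReal.toReal_prod]
  refine Finset.prod_congr rfl fun i _ => ?_
  rw [prod_condProb]
  rfl

theorem fractalMeasure_real_cylinder_le [IsProbabilityMeasure μ] (hm : 2 ≤ m) (hJ : 0 < J)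
    (hp : ∀ j, (p j).Prime) (ω : ℕ → Ω) {K : ℕ} (hK : K ≤ n) :
    (fractalMeasure p μ).real (cylinder (pre n (glueΩ p ω))) ≤
      Real.exp (-∑ k ∈ Finset.range K, ∑ i ∈ coresUpTo p (n / ell p k), info μ k (ω i)) := by
  rw [fractalMeasure_real_cylinder μ hm hJ hp]
  calc _ ≤ ∏ r ∈ Finset.Icc 1 n, Real.exp (-info μ (idx p r) (ω (core p r))) :=
        Finset.prod_le_prod (fun r _ => condProb_nonneg μ _)
          fun r _ => condProb_le_exp_neg_info μ _
    _ ≤ _ := by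
      rw [← Real.exp_sum, Finset.sum_neg_distrib,
        sum_Icc_idx_eq hJ hp n fun i k => info μ k (ω i)]
      refine Real.exp_le_exp.2 (neg_le_neg (Finset.sum_le_sum_of_subset_of_nonneg
        (Finset.range_subset_range.2 (by omega)) fun k _ _ =>
          Finset.sum_nonneg fun i _ => info_nonneg μ _))

theorem le_dimH_fractal [IsProbabilityMeasure μ] (hm : 2 ≤ m) (hJ : 0 < J)
    (hp : ∀ j, (p j).Prime) (hne : Ω.Nonempty) :
    ENNReal.ofReal (entropySum p Ω μ) ≤ dimH (fractal p Ω) := by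
  have hm1 : (1 : ℝ) < m := by exact_mod_cast (by omega : 1 < m)
  have hlm : 0 < Real.log m := Real.log_pos hm1
  refine le_of_forall_lt fun c hc => ?_
  obtain ⟨t, hct, ht⟩ := ENNReal.lt_iff_exists_nnreal_btwn.1 hc
  have ht0 : 0 < t := by exact_mod_cast (zero_le (a := c)).trans_lt hct
  refine hct.trans_le ?_
  have hts : (t : ℝ) < entropySum p Ω μ := by
    rwa [ENNReal.lt_ofReal_iff_toReal_lt ENNReal.coe_ne_top] at ht
  rw [entropySum_eq, lt_div_iff₀ hlm] at hts
  have hlim := (tendsto_sum_sub_div_ell hJ hp (natEntropy_zero μ hm hne) (natEntropy_nonneg μ)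
    (natEntropy_le μ hm hne)).const_mul (gammaS p)⁻¹
  obtain ⟨K, hK⟩ := (hlim.eventually_const_lt hts).exists
  have hae : ∀ᵐ ω ∂Measure.infinitePi (fun _ : ℕ => μ), ∃ n₀, ∀ n ≥ n₀,
      (fractalMeasure p μ).real (cylinder (pre n (glueΩ p ω))) ≤
        Real.exp (-(n * (t * Real.log m))) := by
    filter_upwards [ae_all_iff.2 fun k => ae_tendsto_sum_info (p := p) μ hm hp k] with ω hω
    have h1 : Tendsto (fun n : ℕ =>
        (∑ k ∈ Finset.range K, ∑ i ∈ coresUpTo p (n / ell p k), info μ k (ω i)) / n) atTop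
        (𝓝 (∑ k ∈ Finset.range K, (natEntropy Ω μ (k + 1) - natEntropy Ω μ k) *
          ((gammaS p)⁻¹ / ell p k))) := by
      refine Tendsto.congr (fun n => (Finset.sum_div _ _ _).symm) ?_
      exact tendsto_finsetSum _ fun k _ =>
        tendsto_sum_coresUpTo_div hJ hp (f := fun i => info μ k (ω i)) (hω k) k
    have h2 : ∑ k ∈ Finset.range K, (natEntropy Ω μ (k + 1) - natEntropy Ω μ k) *
          ((gammaS p)⁻¹ / ell p k) = (gammaS p)⁻¹ *
        ∑ k ∈ Finset.range K, (natEntropy Ω μ (k + 1) - natEntropy Ω μ k) / ell p k := by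
      rw [Finset.mul_sum]
      exact Finset.sum_congr rfl fun k _ => by ring
    rw [h2] at h1
    obtain ⟨n₀, hn₀⟩ := eventually_atTop.1 ((h1.eventually_const_lt hK).and
      ((eventually_ge_atTop K).and (eventually_gt_atTop 0)))
    refine ⟨n₀, fun n hn => ?_⟩
    obtain ⟨h3, h4, h5⟩ := hn₀ n hn
    refine (fractalMeasure_real_cylinder_le μ hm hJ hp ω h4).trans (Real.exp_le_exp.2 ?_)
    rw [lt_div_iff₀ (by exact_mod_cast h5)] at h3
    rw [neg_le_neg_iff, mul_comm]
    exact h3.le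
  have hprob : IsProbabilityMeasure (fractalMeasure p μ) :=
    Measure.isProbabilityMeasure_map (measurable_glueΩ hm).aemeasurable
  by_contra hcon
  have hnull : ∀ n₀ : ℕ, fractalMeasure p μ (fractal p Ω ∩ {x | ∀ n ≥ n₀,
      (fractalMeasure p μ).real (cylinder (pre n x)) ≤ Real.exp (-(n * (t * Real.log m)))}) = 0 := by
    intro n₀
    by_contra h0
    have := le_dimH_of_measureReal_cylinder_le hm (fractalMeasure p μ) (by positivity) h0
    rw [mul_div_cancel_right₀ _ hlm.ne', ENNReal.ofReal_coe_nnreal] at this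
    exact hcon this
  have hnull' : ∀ᵐ ω ∂Measure.infinitePi (fun _ : ℕ => μ), ∀ n₀ : ℕ, ¬ (∀ n ≥ n₀,
      (fractalMeasure p μ).real (cylinder (pre n (glueΩ p ω))) ≤
        Real.exp (-(n * (t * Real.log m)))) := by
    refine ae_all_iff.2 fun n₀ => ?_
    have h1 := Measure.preimage_null_of_map_null (measurable_glueΩ hm).aemeasurable (hnull n₀)
    rw [← compl_compl (glueΩ p ⁻¹' _)] at h1
    filter_upwards [mem_ae_iff.2 h1] with ω hω hall
    exact hω ⟨glue_mem_fractal hJ hp fun i => (ω i).2, hall⟩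
  obtain ⟨ω, ⟨n₀, h1⟩, h2⟩ := (hae.and hnull').exists
  exact h2 n₀ h1

end Information

end SymbolicSpace

namespace SymbolicSpace

variable {m J : ℕ} {p : Fin J → ℕ} {Ω : Set (SymbolicSpace m)} {k n : ℕ}

theorem card_prefixes_fractal (hJ : 0 < J) (hp : ∀ j, (p j).Prime) (hne : Ω.Nonempty) (n : ℕ) :
    (prefixes (fractal p Ω) n).card =
      ∏ i ∈ coresUpTo p n, (prefixes Ω (chainLen p n i)).card := by
  obtain ⟨x₀, hx₀⟩ := hne
  rw [← Finset.card_pi]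
  refine Finset.card_bij
    (fun u _ i _ => pre (chainLen p n i) (restrict p i (pad x₀ u))) ?_ ?_ ?_
  · intro u hu
    obtain ⟨y, hy, rfl⟩ := mem_prefixes.1 hu
    rw [Finset.mem_pi]
    intro i hi
    rw [(pre_eq_iff_restrict hJ hp).1 (pre_pad x₀ (pre n y)) i hi]
    exact pre_mem_prefixes ((mem_fractal_iff hJ).1 hy i (mem_coresUpTo.1 hi).2) _
  · intro u _ v _ huv
    rw [← pre_pad x₀ u, ← pre_pad x₀ v, pre_eq_iff_restrict hJ hp]
    exact fun i hi => congrFun (congrFun huv i) hi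
  · intro f hf
    rw [Finset.mem_pi] at hf
    have hex : ∀ i, ∃ y ∈ Ω, ∀ hi : i ∈ coresUpTo p n, pre (chainLen p n i) y = f i hi := by
      intro i
      by_cases hi : i ∈ coresUpTo p n
      · obtain ⟨y, hy, h⟩ := mem_prefixes.1 (hf i hi)
        exact ⟨y, hy, fun _ => h⟩
      · exact ⟨x₀, hx₀, fun h => absurd h hi⟩
    choose ω hω hωf using hex
    refine ⟨pre n (glue p ω), pre_mem_prefixes (glue_mem_fractal hJ hp hω) n, ?_⟩
    funext i hi
    rw [(pre_eq_iff_restrict hJ hp).1 (pre_pad x₀ (pre n (glue p ω))) i hi,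
      restrict_glue hJ hp _ (mem_coresUpTo.1 hi).2, hωf]

/-- The logarithmic growth of the number of prefixes from length `k` to length `k + 1`. -/
def logGrowth (Ω : Set (SymbolicSpace m)) (k : ℕ) : ℝ :=
  Real.log (prefixes Ω (k + 1)).card - Real.log (prefixes Ω k).card

theorem logGrowth_nonneg (hne : Ω.Nonempty) (k : ℕ) : 0 ≤ logGrowth Ω k := by
  have h : (0 : ℝ) < (prefixes Ω k).card := by exact_mod_cast card_prefixes_pos hne k
  exact sub_nonneg.2 (Real.log_le_log h (by exact_mod_cast card_prefixes_le_succ Ω k))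

theorem logGrowth_le (hm : 2 ≤ m) (hne : Ω.Nonempty) (k : ℕ) : logGrowth Ω k ≤ Real.log m := by
  have h : (0 : ℝ) < (prefixes Ω k).card := by exact_mod_cast card_prefixes_pos hne k
  have h' : (0 : ℝ) < (prefixes Ω (k + 1)).card := by exact_mod_cast card_prefixes_pos hne (k + 1)
  have hm0 : (0 : ℝ) < m := by exact_mod_cast (by omega : 0 < m)
  rw [logGrowth, sub_le_iff_le_add', ← Real.log_mul h.ne' hm0.ne']
  exact Real.log_le_log h' (by exact_mod_cast card_prefixes_succ_le Ω k)

theorem abs_logGrowth_le (hm : 2 ≤ m) (hne : Ω.Nonempty) (k : ℕ) :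
    |logGrowth Ω k| ≤ Real.log m := by
  rw [abs_of_nonneg (logGrowth_nonneg hne k)]
  exact logGrowth_le hm hne k

theorem log_card_prefixes_fractal (hJ : 0 < J) (hp : ∀ j, (p j).Prime) (hne : Ω.Nonempty) (n : ℕ) :
    Real.log (prefixes (fractal p Ω) n).card = ∑ r ∈ Finset.Icc 1 n, logGrowth Ω (idx p r) := by
  rw [sum_Icc_eq_sum_chains hJ hp n fun _ k => logGrowth Ω k, card_prefixes_fractal hJ hp hne,
    Nat.cast_prod, Real.log_prod fun i _ => by exact_mod_cast (card_prefixes_pos hne _).ne']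
  refine Finset.sum_congr rfl fun i _ => ?_
  simp only [logGrowth]
  rw [Finset.sum_range_sub fun k => Real.log (prefixes Ω k).card]
  simp [prefixes_zero hne]

/-- The exponential growth rate of the number of prefixes of the fractal. -/
def growthRate (p : Fin J → ℕ) (Ω : Set (SymbolicSpace m)) : ℝ :=
  (gammaS p)⁻¹ * ∑' k, logGrowth Ω k / ell p k

theorem tendsto_log_card_prefixes_div (hm : 2 ≤ m) (hJ : 0 < J) (hp : ∀ j, (p j).Prime)
    (hne : Ω.Nonempty) :
    Tendsto (fun n : ℕ => Real.log (prefixes (fractal p Ω) n).card / n) atTop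
      (𝓝 (growthRate p Ω)) := by
  refine (tendsto_sum_idx_div_gammaS hJ hp (abs_logGrowth_le hm hne)).congr fun n => ?_
  rw [log_card_prefixes_fractal hJ hp hne]

section Covering

variable {X : Set (SymbolicSpace m)} {ε : ℝ≥0}

theorem coveringNumber_le_card_prefixes (hm : 2 ≤ m) (h : ((m : ℝ)⁻¹) ^ (n + 1) ≤ ε) :
    Metric.coveringNumber ε X ≤ (prefixes X n).card := by
  classical
  rcases X.eq_empty_or_nonempty with rfl | ⟨x₀, hx₀⟩
  · simp
  have hex : ∀ u : Fin n → Fin m, ∃ x ∈ X, u ∈ prefixes X n → pre n x = u := by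
    intro u
    by_cases hu : u ∈ prefixes X n
    · obtain ⟨x, hx, h⟩ := mem_prefixes.1 hu
      exact ⟨x, hx, fun _ => h⟩
    · exact ⟨x₀, hx₀, fun h => absurd h hu⟩
  choose f hfX hf using hex
  refine (Metric.IsCover.coveringNumber_le_encard (C := f '' (prefixes X n : Set (Fin n → Fin m)))
    ?_ ?_).trans ((Set.encard_image_le _ _).trans_eq (Set.encard_coe_eq_coe_finsetCard _))
  · rintro _ ⟨u, _, rfl⟩
    exact hfX u
  · intro x hx
    have hu := pre_mem_prefixes hx n
    refine ⟨f (pre n x), ⟨_, hu, rfl⟩, ?_⟩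
    change edist x (f (pre n x)) ≤ ε
    rw [edist_dist, ENNReal.ofReal_le_iff_le_toReal ENNReal.coe_ne_top, ENNReal.coe_toReal]
    exact (dist_le_of_pre_eq hm (hf _ hu).symm).trans h

theorem card_prefixes_le_coveringNumber (hm : 2 ≤ m) (h : (ε : ℝ) < ((m : ℝ)⁻¹) ^ n) :
    ((prefixes X n).card : ℕ∞) ≤ Metric.coveringNumber ε X := by
  refine le_iInf₂ fun C hCX => le_iInf fun hC => ?_
  rw [← Set.encard_coe_eq_coe_finsetCard]
  refine (Set.encard_le_encard (t := pre n '' C) fun u hu => ?_).trans (Set.encard_image_le _ _)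
  obtain ⟨x, hx, rfl⟩ := mem_prefixes.1 hu
  obtain ⟨y, hy, hxy⟩ := hC hx
  refine ⟨y, hy, (pre_eq_of_dist_lt hm (lt_of_le_of_lt ?_ h)).symm⟩
  change edist x y ≤ ε at hxy
  rwa [edist_dist, ENNReal.ofReal_le_iff_le_toReal ENNReal.coe_ne_top, ENNReal.coe_toReal] at hxy

theorem coveringNumber_eq_card_prefixes (hm : 2 ≤ m) (h1 : ((m : ℝ)⁻¹) ^ (n + 1) ≤ ε)
    (h2 : (ε : ℝ) < ((m : ℝ)⁻¹) ^ n) : Metric.coveringNumber ε X = (prefixes X n).card :=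
  le_antisymm (coveringNumber_le_card_prefixes hm h1) (card_prefixes_le_coveringNumber hm h2)

theorem tendsto_log_one_div_nnreal :
    Tendsto (fun ε : ℝ≥0 => Real.log (1 / (ε : ℝ))) (𝓝[>] 0) atTop := by
  have h1 : Tendsto (fun ε : ℝ≥0 => (ε : ℝ)) (𝓝[>] 0) (𝓝[>] 0) := by
    refine tendsto_nhdsWithin_iff.2 ⟨?_, ?_⟩
    · exact (NNReal.continuous_coe.tendsto 0).mono_left nhdsWithin_le_nhds
    · filter_upwards [self_mem_nhdsWithin] with ε hε
      exact NNReal.coe_pos.2 hε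
  refine (tendsto_neg_atBot_atTop.comp (Real.tendsto_log_nhdsGT_zero.comp h1)).congr fun ε => ?_
  simp

/-- The box-counting dimension is the growth rate of the number of prefixes. -/
theorem hasMinkowskiDim_of_tendsto (hm : 2 ≤ m) {b : ℝ}
    (h : Tendsto (fun n : ℕ => Real.log (prefixes X n).card / n) atTop (𝓝 b)) :
    HasMinkowskiDim X (b / Real.log m) := by
  have hm1 : (1 : ℝ) < m := by exact_mod_cast (by omega : 1 < m)
  have hlm : 0 < Real.log m := Real.log_pos hm1
  refine ⟨fun ε hε => ?_, ?_⟩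
  · obtain ⟨n, hn⟩ := exists_pow_lt_of_lt_one (NNReal.coe_pos.2 hε) (inv_lt_one_of_one_lt₀ hm1)
    refine ne_top_of_le_ne_top (ENat.natCast_ne_top _)
      (coveringNumber_le_card_prefixes (n := n) hm (le_trans ?_ hn.le))
    exact pow_le_pow_of_le_one (by positivity) (inv_lt_one_of_one_lt₀ hm1).le (Nat.le_succ n)
  · have hG : Tendsto (fun x : ℝ => Real.log (prefixes X (⌈x⌉₊ - 1)).card / x) atTop (𝓝 b) := by
      have h1 : Tendsto (fun x : ℝ => ⌈x⌉₊ - 1) atTop atTop :=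
        (tendsto_sub_atTop_nat 1).comp tendsto_nat_ceil_atTop
      have h2 : Tendsto (fun x : ℝ => ((⌈x⌉₊ - 1 : ℕ) : ℝ) / x) atTop (𝓝 1) := by
        have h3 := (tendsto_nat_ceil_div_atTop (R := ℝ)).sub (tendsto_inv_atTop_zero (𝕜 := ℝ))
        rw [sub_zero] at h3
        refine h3.congr' ?_
        filter_upwards [eventually_gt_atTop 0] with x hx
        rw [Nat.cast_sub (Nat.one_le_iff_ne_zero.2 (Nat.ceil_pos.2 hx).ne')]
        push_cast
        ring
      have h4 := (h.comp h1).mul h2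
      rw [mul_one] at h4
      refine h4.congr' ?_
      filter_upwards [h1.eventually_gt_atTop 0] with x hx
      exact div_mul_div_cancel₀ (by exact_mod_cast hx.ne')
    have hL : Tendsto (fun ε : ℝ≥0 => Real.log (1 / (ε : ℝ)) / Real.log m) (𝓝[>] 0) atTop :=
      tendsto_log_one_div_nnreal.atTop_div_const hlm
    refine ((hG.comp hL).div_const (Real.log m)).congr' ?_
    filter_upwards [self_mem_nhdsWithin, hL.eventually_gt_atTop 0] with ε hε hL0
    have hε' : (0 : ℝ) < ε := NNReal.coe_pos.2 hε
    simp only [Function.comp_apply]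
    set L := Real.log (1 / (ε : ℝ)) / Real.log m with hLdef
    have hεL : (ε : ℝ) = Real.exp (-(L * Real.log m)) := by
      rw [hLdef, div_mul_cancel₀ _ hlm.ne', one_div, Real.log_inv, neg_neg, Real.exp_log hε']
    have hpow : ∀ n : ℕ, ((m : ℝ)⁻¹) ^ n = Real.exp (-(n * Real.log m)) := by
      intro n
      rw [← Real.rpow_natCast, Real.rpow_def_of_pos (by positivity), Real.log_inv]
      congr 1
      ring
    obtain ⟨n, hn⟩ : ∃ n, ⌈L⌉₊ = n + 1 := Nat.exists_eq_succ_of_ne_zero (Nat.ceil_pos.2 hL0).ne'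
    have hn1 : L ≤ (n + 1 : ℕ) := by rw [← hn]; exact Nat.le_ceil L
    have hn2 : (n : ℝ) < L := Nat.lt_ceil.1 (by omega)
    rw [coveringNumber_eq_card_prefixes (n := n) hm, hn, Nat.add_sub_cancel, ENat.toNat_natCast,
      div_div, hLdef, div_mul_cancel₀ _ hlm.ne']
    · rw [hpow, hεL, Real.exp_le_exp, neg_le_neg_iff]
      exact mul_le_mul_of_nonneg_right hn1 hlm.le
    · rw [hpow, hεL, Real.exp_lt_exp, neg_lt_neg_iff]
      exact mul_lt_mul_of_pos_right hn2 hlm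

end Covering

theorem summable_logGrowth_div (hm : 2 ≤ m) (hJ : 0 < J) (hp : ∀ j, (p j).Prime)
    (hne : Ω.Nonempty) : Summable fun k => logGrowth Ω k / ell p k := by
  refine Summable.of_nonneg_of_le
    (fun k => div_nonneg (logGrowth_nonneg hne k) (by positivity)) (fun k => ?_)
    ((summable_inv_ell hJ hp).mul_left (Real.log m))
  rw [mul_one_div]
  exact div_le_div_of_nonneg_right (logGrowth_le hm hne k) (by positivity)

theorem log_card_prefixes_nonneg (Ω : Set (SymbolicSpace m)) (k : ℕ) :
    0 ≤ Real.log (prefixes Ω k).card := Real.log_natCast_nonneg _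

theorem tsum_log_card_prefixes (hm : 2 ≤ m) (hJ : 0 < J) (hp : ∀ j, (p j).Prime)
    (hne : Ω.Nonempty) :
    ∑' k, Real.log (prefixes Ω (k + 1)).card * (1 / (ell p k : ℝ) - 1 / (ell p (k + 1) : ℝ)) =
      ∑' k, logGrowth Ω k / ell p k :=
  tendsto_nhds_unique
    (tendsto_sum_sub_div_ell hJ hp (h := fun k => Real.log (prefixes Ω k).card)
      (by simp [prefixes_zero hne]) (log_card_prefixes_nonneg Ω) (log_card_prefixes_le hne))
    (summable_logGrowth_div hm hJ hp hne).hasSum.tendsto_sum_nat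

theorem symmetric_of_pot_eq (hm : 2 ≤ m) (hJ : 0 < J) (hp : ∀ j, (p j).Prime)
    (hne : Ω.Nonempty) (h : pot p Ω 0 Fin.elim0 = ∑' k, logGrowth Ω k / ell p k) :
    PrefixTreeSphericallySymmetric Ω := by
  rw [← tsum_weightEntropy hm hJ hp hne, ← tsum_log_card_prefixes hm hJ hp hne] at h
  have hent : ∀ k, weightEntropy p Ω (k + 1) = Real.log (prefixes Ω (k + 1)).card := by
    by_contra! hcon
    obtain ⟨k, hk⟩ := hcon
    refine (Summable.tsum_lt_tsum (i := k) (fun j => ?_) ?_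
      (summable_weightEntropy hm hJ hp hne) ?_).ne h
    · exact mul_le_mul_of_nonneg_right (weightEntropy_le_log_card hm hJ hp hne _)
        (one_div_ell_sub_pos hJ hp j).le
    · exact mul_lt_mul_of_pos_right ((weightEntropy_le_log_card hm hJ hp hne _).lt_of_ne hk)
        (one_div_ell_sub_pos hJ hp k)
    · exact summable_mul_one_div_ell_sub hJ hp (h := fun k => Real.log (prefixes Ω k).card)
        (log_card_prefixes_nonneg Ω) (log_card_prefixes_le hne)
  have hunif : ∀ k, ∀ u ∈ prefixes Ω k, weight p Ω k u = 1 / (prefixes Ω k).card := by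
    intro k
    refine eq_of_sum_negMulLog_eq_log_card (fun u _ => (weight_pos k u).le)
      (sum_weight hm hJ hp hne k) ?_
    cases k with
    | zero => simpa [prefixes_zero hne, weightEntropy] using weightEntropy_zero (p := p) hne
    | succ k => exact hent k
  have hcard : ∀ k, ∀ u ∈ prefixes Ω k,
      ((continuations Ω u).card : ℝ) = (prefixes Ω (k + 1)).card / (prefixes Ω k).card := by
    intro k u hu
    have h1 := sum_weight_snoc hm hJ hp hu
    rw [hunif k u hu, Finset.sum_congr rfl fun a ha =>
      hunif (k + 1) _ (mem_continuations_iff.1 ha), Finset.sum_const, nsmul_eq_mul] at h1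
    have h2 : ((prefixes Ω (k + 1)).card : ℝ) ≠ 0 := by
      exact_mod_cast (card_prefixes_pos hne (k + 1)).ne'
    field_simp at h1 ⊢
    linarith
  intro k u hu v hv
  have := (hcard k u hu).trans (hcard k v hv).symm
  exact_mod_cast this

theorem pot_eq_of_symmetric (hm : 2 ≤ m) (hJ : 0 < J) (hp : ∀ j, (p j).Prime)
    (hne : Ω.Nonempty) (h : PrefixTreeSphericallySymmetric Ω) :
    pot p Ω 0 Fin.elim0 = ∑' k, logGrowth Ω k / ell p k := by
  have hcont : ∀ k, ∀ u ∈ prefixes Ω k,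
      Real.log (continuations Ω u).card = logGrowth Ω k := by
    intro k u hu
    have h1 : (prefixes Ω (k + 1)).card = (prefixes Ω k).card * (continuations Ω u).card := by
      rw [card_prefixes_succ, Finset.sum_congr rfl fun v hv => h k v hv u hu, Finset.sum_const,
        smul_eq_mul]
    have h2 : ((prefixes Ω k).card : ℝ) ≠ 0 := by exact_mod_cast (card_prefixes_pos hne k).ne'
    have h3 : ((continuations Ω u).card : ℝ) ≠ 0 := by
      exact_mod_cast (continuations_nonempty hu).card_pos.ne'
    rw [logGrowth, h1, Nat.cast_mul, Real.log_mul h2 h3]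
    ring
  have htrunc : ∀ d k, ∀ u ∈ prefixes Ω k, potTrunc p Ω d k u =
      ∑ j ∈ Finset.range d, logGrowth Ω (j + k) / ell p (j + k) := by
    intro d
    induction d with
    | zero => intro k u _; simp [potTrunc]
    | succ d ih =>
      intro k u hu
      have hl := ell_pos_real hJ hp k
      have h3 : ((continuations Ω u).card : ℝ) ≠ 0 := by
        exact_mod_cast (continuations_nonempty hu).card_pos.ne'
      rw [potTrunc, Finset.sum_congr rfl fun a ha => by
          rw [ih (k + 1) _ (mem_continuations_iff.1 ha)], Finset.sum_const, nsmul_eq_mul,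
        Real.log_mul h3 (Real.exp_pos _).ne', Real.log_exp, hcont k u hu, Finset.sum_range_succ',
        zero_add, mul_add, inv_mul_cancel_left₀ hl.ne', add_comm, inv_mul_eq_div]
      congr 1
      exact Finset.sum_congr rfl fun j _ => by rw [add_assoc, add_comm 1 k]
  have h0 : Fin.elim0 ∈ prefixes Ω 0 := by rw [prefixes_zero hne]; exact Finset.mem_singleton_self _
  refine tendsto_nhds_unique (tendsto_potTrunc hm hJ hp 0 Fin.elim0)
    ((summable_logGrowth_div hm hJ hp hne).hasSum.tendsto_sum_nat.congr fun d => ?_)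
  rw [htrunc d 0 _ h0]
  rfl

end SymbolicSpace

end

theorem theorem2p2 {m J : ℕ} (hm : 2 ≤ m) (hJ : 2 ≤ J)
    (p : Fin J → ℕ) (hp : ∀ j, (p j).Prime) (hpinj : Function.Injective p)
    (Ω : Set (SymbolicSpace m)) (hΩ : IsClosed Ω) (hne : Ω.Nonempty) :
    -- the series in the definitions of `γ(S)` and of `s(Ω, μ)` converge
    (Summable fun k : ℕ => 1 / (ell p k : ℝ)) ∧
    (∀ μ : ProbabilityMeasure Ω, Summable (SymbolicSpace.entropyTerm p Ω (μ : Measure Ω))) ∧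
    -- (i)
    dimH (SymbolicSpace.fractal p Ω) =
      ⨆ μ : ProbabilityMeasure Ω,
        ENNReal.ofReal (SymbolicSpace.entropySum p Ω (μ : Measure Ω)) ∧
    -- (ii)
    ∃ d : ℝ, HasMinkowskiDim (SymbolicSpace.fractal p Ω) d ∧
      (dimH (SymbolicSpace.fractal p Ω) = ENNReal.ofReal d ↔
        SymbolicSpace.PrefixTreeSphericallySymmetric Ω) := by
  have hJ0 : 0 < J := by omega
  have hm1 : (1 : ℝ) < m := by exact_mod_cast (by omega : 1 < m)
  have hlm : 0 < Real.log m := Real.log_pos hm1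
  have hγ : 0 < (gammaS p)⁻¹ := inv_pos.2 (gammaS_pos hJ0 hp)
  have hge : ⨆ μ : ProbabilityMeasure Ω,
      ENNReal.ofReal (SymbolicSpace.entropySum p Ω (μ : Measure Ω)) ≤
        dimH (SymbolicSpace.fractal p Ω) :=
    iSup_le fun μ => SymbolicSpace.le_dimH_fractal (μ : Measure Ω) hm hJ0 hp hne
  have hle := SymbolicSpace.dimH_fractal_le hm hJ0 hp hne
  have hpot := SymbolicSpace.pot_le_iSup_entropySum hm hJ0 hp hne
  refine ⟨summable_inv_ell hJ0 hp,
    fun μ => SymbolicSpace.summable_entropyTerm (μ : Measure Ω) hm hJ0 hp hne,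
    le_antisymm (hle.trans hpot) hge, SymbolicSpace.growthRate p Ω / Real.log m,
    SymbolicSpace.hasMinkowskiDim_of_tendsto hm
      (SymbolicSpace.tendsto_log_card_prefixes_div hm hJ0 hp hne), ?_⟩
  have hpot0 := SymbolicSpace.pot_nonneg (Ω := Ω) hm hJ0 hp 0 Fin.elim0
  have hrate0 : 0 ≤ ∑' k, SymbolicSpace.logGrowth Ω k / ell p k :=
    tsum_nonneg fun k => div_nonneg (SymbolicSpace.logGrowth_nonneg hne k) (by positivity)
  rw [le_antisymm hle (hpot.trans hge), SymbolicSpace.growthRate,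
    ENNReal.ofReal_eq_ofReal_iff (by positivity) (by positivity), div_left_inj' hlm.ne',
    mul_right_inj' hγ.ne']
  exact ⟨SymbolicSpace.symmetric_of_pot_eq hm hJ0 hp hne,
    SymbolicSpace.pot_eq_of_symmetric hm hJ0 hp hne⟩
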